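/- **Setting.** For $\mathbf n=(n_1,n_2,n_3)$ let $K(\mathbf n)$ be the graph with vertices $(x_1,x_2,x_3)$, $1\le x_i\le n_i$, two vertices being adjacent iff they differ in all three coordinates (the direct product $K_{n_1}\times K_{n_2}\times K_{n_3}$). A set $S$ of vertices of a finite connected graph $G$ *resolves* $G$ if for any two distinct vertices $x,y\notin S$ there is $w\in S$ with $d(x,w)\ne d(y,w)$. The *middle cone* consists of all $\mathbf n\in\mathbb N^3$ with $3\le n_1\le n_3$, $3\le n_2\le n_3$ and $3\max(n_1,n_2)\le 2n_3\le n_1n_2$. For a set $W$ of vertices of $K(\mathbf n)$ let $W_{i,a}$ be the set of elements of $W$ whose $i$-th coordinate is $a$. The nonempty sets $W_{i,a}$ are the hyperedges of color $i$ of the landmark graph of $W$ (color 1 blue, 2 green, 3 pink); a *stick* is a hyperedge with exactly two vertices. $W$ is a *basic landmark system* for $K(\mathbf n)$ if for each $i$ there are $n_i$ hyperedges of color $i$, every hyperedge has at least two vertices, and hyperedges of different colors meet in at most one vertex. A *bad 4-cycle* consists of distinct $w_1,w_2,w_3,w_4\in W$ and three different colors $i,j,k$ such that $\{w_1,w_2\}$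 and $\{w_3,w_4\}$ are sticks of color $i$, $w_2,w_3$ lie in a common hyperedge of color $j$, and $w_4,w_1$ lie in a common hyperedge of color $k$. **Construction.** Let $\mathbf n$ be in the middle cone, $f=\lfloor n_2/2\rfloor$, and $n_3=qn_1+r$ with $0\le r<n_1$. Define multiplicities $\ell_1,\dots,\ell_{n_1}$: put $m=\min(r,n_1-r)$; for $i\le 2m$ let $\ell_i=q+1$ if $i$ is odd and $\ell_i=q$ if $i$ is even; for $i>2m$ let $\ell_i=q$ if $r\le n_1-r$ and $\ell_i=q+1$ otherwise. Then $\sum_i\ell_i=n_3$. Let $s_i=1+\sum_{j<i}\ell_j$. Define two $3\times n_3$ matrices, "left" and "right", as follows. * Third row of both: $1,2,\dots,n_3$. * First row: on the left $1^{(\ell_1)},2^{(\ell_2)},\dots,n_1^{(\ell_{n_1})}$, on the right $2^{(\ell_1)},3^{(\ell_2)},\dots,n_1^{(\ell_{n_1-1})},1^{(\ell_{n_1})}$, where exponents denote repetition. * Second row, $n_2$ even: on the left $1,2,\dots,f$ repeated periodically; on the right the same with $f$ added to each entry (both truncated to $n_3$ columns). * Second row, $n_2$ odd: start with the same two rows.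 To insert a pair of neutrals at position $c$ means to insert the entry $n_2$ in column $c$ of the left second row and in column $c+1$ of the right second row, shifting the later entries one column to the right and dropping the entry pushed out of the matrix. If $\ell_i>f$ for more than one $i$, insert a pair of neutrals at position $s_i$ for each such $i$, in increasing order of $i$. If $\ell_i>f$ for at most one $i$, insert a pair of neutrals at position $1$, then choose any column $(x,1,z)$ of the left matrix with $x\notin\{1,2,n_1\}$ and change it to $(x,n_2,z)$. $W$ is the set of all columns of the two matrices. **Claim.** For every $\mathbf n$ in the middle cone the construction can be carried out, and for every $W$ it can produce: 1. $W$ is a basic landmark system for $K(\mathbf n)$; 2. every stick of the landmark graph of $W$ is pink; 3. the landmark graph of $W$ has no bad 4-cycle; 4. $W$ resolves $K(\mathbf n)$; 5. $W\cup\{u\}$, where $u=(n_1+1,n_2+1,n_3+1)$, resolves $K(n_1+1,n_2+1,n_3+1)$. -/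

import Mathlib

namespace LandmarkGraph

/-- A set of landmarks `S` resolves the (finite connected) graph `G` if any two distinct vertices
outside `S` have different distances to some landmark in `S`. -/
def Resolves {V : Type*} (G : SimpleGraph V) (S : Set V) : Prop :=
  ∀ x y : V, x ∉ S → y ∉ S → x ≠ y → ∃ w ∈ S, G.dist x w ≠ G.dist y w

/-- Points of `ℕ³`. The coordinates (colors) are indexed by `0, 1, 2 : Fin 3`:
`0` is blue, `1` is green, `2` is pink. -/
abbrev Point := Fin 3 → ℕ

/-- The vertex set of `K(n)`: triples with `1 ≤ xᵢ ≤ nᵢ`. -/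
def vertexSet (n : Fin 3 → ℕ) : Set Point := {x | ∀ i, 1 ≤ x i ∧ x i ≤ n i}

/-- The direct product `K(n)` of three complete graphs: two vertices are adjacent iff they
differ in every coordinate. -/
def K (n : Fin 3 → ℕ) : SimpleGraph (vertexSet n) where
  Adj x y := ∀ i, x.1 i ≠ y.1 i
  symm := ⟨fun _ _ h i => (h i).symm⟩
  loopless := ⟨fun _ h => h 0 rfl⟩

/-- A finite set `W` of points consists of vertices of `K(n)` and resolves `K(n)`. -/
def ResolvesK (n : Fin 3 → ℕ) (W : Finset Point) : Prop :=
  (∀ w ∈ W, w ∈ vertexSet n) ∧ Resolves (K n) {v | v.1 ∈ W}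

/-- The middle cone: `3 ≤ n₁, n₂ ≤ n₃` and `3 max(n₁, n₂) ≤ 2 n₃ ≤ n₁ n₂`. -/
structure MiddleCone (n : Fin 3 → ℕ) : Prop where
  three_le_fst : 3 ≤ n 0
  three_le_snd : 3 ≤ n 1
  fst_le : n 0 ≤ n 2
  snd_le : n 1 ≤ n 2
  lower : 3 * max (n 0) (n 1) ≤ 2 * n 2
  upper : 2 * n 2 ≤ n 0 * n 1

/-! ### The landmark graph -/

/-- `W_{i,a}`: the landmarks whose `i`-th coordinate is `a`. The hyperedges of color `i` of the
landmark graph of `W` are the nonempty sets among these. -/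
def hyperedge (W : Finset Point) (i : Fin 3) (a : ℕ) : Finset Point :=
  W.filter fun w => w i = a

/-- Basic landmark systems for `K(n)`. -/
structure IsBasicLandmarkSystem (n : Fin 3 → ℕ) (W : Finset Point) : Prop where
  subset : ∀ w ∈ W, w ∈ vertexSet n
  /-- there are `nᵢ` hyperedges of color `i` -/
  full : ∀ i, {a : ℕ | (hyperedge W i a).Nonempty}.ncard = n i
  /-- each hyperedge has at least two vertices -/
  two_le : ∀ i a, (hyperedge W i a).Nonempty → 2 ≤ (hyperedge W i a).card
  /-- hyperedges of different colors meet in at most one vertex -/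
  inter : ∀ i j a b, i ≠ j → (hyperedge W i a ∩ hyperedge W j b).card ≤ 1

/-- Every stick (hyperedge with exactly two vertices) is pink. -/
def SticksArePink (W : Finset Point) : Prop :=
  ∀ i a, (hyperedge W i a).card = 2 → i = 2

/-- A bad 4-cycle: a 4-cycle `w₁ w₂ w₃ w₄` in the landmark graph whose edges use all three colors,
such that the two edges of the same color `i` (which are necessarily opposite: `w₁w₂` and `w₃w₄`)
are sticks. The other two edges, of colors `j` and `k`, may have any size. -/
def HasBadFourCycle (W : Finset Point) : Prop :=
  ∃ w₁ w₂ w₃ w₄ : Point, [w₁, w₂, w₃, w₄].Nodup ∧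
    ∃ i j k : Fin 3, i ≠ j ∧ i ≠ k ∧ j ≠ k ∧
      ∃ a b c d : ℕ, hyperedge W i a = {w₁, w₂} ∧ {w₂, w₃} ⊆ hyperedge W j c ∧
        hyperedge W i b = {w₃, w₄} ∧ {w₄, w₁} ⊆ hyperedge W k d

/-- The point `u = (n₁ + 1, n₂ + 1, n₃ + 1)` carrying the triple loop; it is also the parameter
`n + 1` of the larger graph. -/
def bump (n : Fin 3 → ℕ) : Point := fun i => n i + 1

/-! ### The construction -/

/-- The multiplicity `ℓᵢ` (`1 ≤ i ≤ n₁`). Writing `n₃ = q n₁ + r`, the multiplicities alternate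
`q + 1, q, q + 1, q, …` with `min r (n₁ - r)` such pairs; the remaining ones are all `q` if
`r ≤ n₁ - r` and all `q + 1` otherwise. -/
def mult (n : Fin 3 → ℕ) (i : ℕ) : ℕ :=
  let q := n 2 / n 0
  let r := n 2 % n 0
  if i ≤ 2 * min r (n 0 - r) then (if i % 2 = 1 then q + 1 else q)
  else if r ≤ n 0 - r then q else q + 1

/-- The start of blue block `i`: column `1 + ℓ₁ + ⋯ + ℓ_{i-1}`. -/
def blockStart (n : Fin 3 → ℕ) (i : ℕ) : ℕ := 1 + ∑ j ∈ Finset.Ico 1 i, mult n j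

/-- Column `c` of the first row `1^(ℓ₁), 2^(ℓ₂), …, n₁^(ℓ_{n₁})` on the left side: the number of
blue blocks that start at or before column `c`. -/
def blueL (n : Fin 3 → ℕ) (c : ℕ) : ℕ :=
  ((Finset.Icc 1 (n 0)).filter fun i => blockStart n i ≤ c).card

/-- Column `c` of the first row on the right side: add one mod `n₁` (with values in `1, …, n₁`). -/
def blueR (n : Fin 3 → ℕ) (c : ℕ) : ℕ := blueL n c % n 0 + 1

/-- `f = ⌊n₂ / 2⌋`. -/
def half (n : Fin 3 → ℕ) : ℕ := n 1 / 2

/-- The blue blocks `i` with `ℓᵢ > f`. -/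
def longBlocks (n : Fin 3 → ℕ) : Finset ℕ :=
  (Finset.Icc 1 (n 0)).filter fun i => half n < mult n i

/-- The positions at which pairs of neutrals are inserted: none if `n₂` is even; if `n₂` is odd,
the starts of the blue blocks with `ℓᵢ > f` when there is more than one such block, and position
`1` otherwise. -/
def insertPositions (n : Fin 3 → ℕ) : Finset ℕ :=
  if Even (n 1) then ∅
  else if 1 < (longBlocks n).card then (longBlocks n).image (blockStart n)
  else {1}

/-- Column `c` of the row obtained from the periodic row `1, 2, …, f, 1, 2, …, f, …`, shifted by
`s`, by inserting the entry `v` so that it occupies exactly the columns in `P`, each insertion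
pushing the later entries one column to the right: a column outside `P` carries the periodic
entry whose index is `c` minus the number of insertions before `c`. -/
def insertedRow (f s v : ℕ) (P : Finset ℕ) (c : ℕ) : ℕ :=
  if c ∈ P then v else s + (c - 1 - (P.filter (· < c)).card) % f + 1

/-- Column `c` of the second row on the left side (before any replacement). -/
def greenL (n : Fin 3 → ℕ) (c : ℕ) : ℕ := insertedRow (half n) 0 (n 1) (insertPositions n) c

/-- Column `c` of the second row on the right side: the periodic entries are increased by `f`, and
neutrals are inserted one column further to the right than on the left side. -/
def greenR (n : Fin 3 → ℕ) (c : ℕ) : ℕ :=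
  insertedRow (half n) (half n) (n 1) ((insertPositions n).image (· + 1)) c

/-- The landmarks on the left side, before any replacement. -/
def leftSide (n : Fin 3 → ℕ) : Finset Point :=
  (Finset.Icc 1 (n 2)).image fun c => ![blueL n c, greenL n c, c]

/-- The landmarks on the right side. -/
def rightSide (n : Fin 3 → ℕ) : Finset Point :=
  (Finset.Icc 1 (n 2)).image fun c => ![blueR n c, greenR n c, c]

/-- `W` is produced by the construction. If `n₂` is odd and at most one multiplicity exceeds `f`,
one chosen left landmark `(x, 1, z)` with `x ∉ {1, 2, n₁}` is replaced by `(x, n₂, z)`;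
otherwise nothing is replaced. -/
def IsConstructed (n : Fin 3 → ℕ) (W : Finset Point) : Prop :=
  if Odd (n 1) ∧ (longBlocks n).card ≤ 1 then
    ∃ x z : ℕ, ![x, 1, z] ∈ leftSide n ∧ x ≠ 1 ∧ x ≠ 2 ∧ x ≠ n 0 ∧
      W = insert ![x, n 1, z] ((leftSide n).erase ![x, 1, z]) ∪ rightSide n
  else W = leftSide n ∪ rightSide n

end LandmarkGraph

namespace LandmarkGraph

/-! Only adjacency matters among the distances: a landmark is non-adjacent to a vertex exactly when
it lies in one of the three hyperedges named by the vertex's coordinates. If `x` and `y` see the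
same landmarks in this sense and differ in color `i`, then the hyperedge of `x` in color `i` is
covered by the hyperedges of `y` in the two other colors. Each of these meets it at most once, so it
is a stick, hence pink. Therefore `x` and `y` agree in blue and green, and their common blue and
green hyperedges join their two pink sticks to a bad 4-cycle (`eq_of_same_landmarks`). The same
domination argument copes with the extra landmark `u`. So both resolving claims follow from the
first three.

For those three, `IsColumnSystem` isolates what is needed of the matrices. Each column is a pink
stick with one landmark on each side; the right blue row is a cyclic shift of the left one, and the
periodic green entries of the two sides are disjoint. Green coincidences across the sides thus come
from neutrals only, and these sit in blocks that are not cyclic neighbors (`neutral_cross`). On one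
side, a blue block of length at most `f` repeats no periodic green entry, and a block of length `f +
1` is repaired by its neutral (`greenRow_inj`). The upper bound of the cone keeps blocks this short;
the lower bound gives every blue and every periodic green value three occurrences, so neither makes
a stick. A single pair of neutrals would make `n₂` a green stick; the replacement supplies its third
occurrence. -/

/-! ### Resolving from the absence of bad 4-cycles. -/

lemma mem_hyperedge {W : Finset Point} {i : Fin 3} {a : ℕ} {w : Point} :
    w ∈ hyperedge W i a ↔ w ∈ W ∧ w i = a := by
  simp [hyperedge]

/-- In `K(n)` a landmark `w` separates vertices `x, y ≠ w` if exactly one of them shares a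
coordinate with `w`. -/
lemma resolvesK_of_forall {n : Fin 3 → ℕ} {W : Finset Point} (hW : ∀ w ∈ W, w ∈ vertexSet n)
    (h : ∀ x ∈ vertexSet n, ∀ y ∈ vertexSet n, x ∉ W → y ∉ W →
      (∀ w ∈ W, (∃ i, w i = x i) ↔ ∃ i, w i = y i) → x = y) : ResolvesK n W := by
  refine ⟨hW, fun x y hx hy hxy => ?_⟩
  by_contra! hd
  refine hxy (Subtype.ext (h x.1 x.2 y.1 y.2 hx hy fun w hw => ?_))
  have key : (K n).Adj x ⟨w, hW w hw⟩ ↔ (K n).Adj y ⟨w, hW w hw⟩ := by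
    rw [← SimpleGraph.dist_eq_one_iff_adj, ← SimpleGraph.dist_eq_one_iff_adj,
      hd ⟨w, hW w hw⟩ hw]
  have hadj : ∀ v : vertexSet n, (K n).Adj v ⟨w, hW w hw⟩ ↔ ¬ ∃ i, w i = v.1 i := by
    intro v
    push Not
    exact forall_congr' fun i => ne_comm
  rw [hadj, hadj] at key
  exact not_iff_not.mp key

/-- The field `full` only counts hyperedges; since their labels lie in `[1, nᵢ]`, the count forces
every label to occur. -/
lemma IsBasicLandmarkSystem.nonempty {n : Fin 3 → ℕ} {W : Finset Point}
    (hW : IsBasicLandmarkSystem n W) {i : Fin 3} {a : ℕ} (h1 : 1 ≤ a) (h2 : a ≤ n i) :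
    (hyperedge W i a).Nonempty := by
  have hsub : {a : ℕ | (hyperedge W i a).Nonempty} ⊆ Set.Icc 1 (n i) := by
    rintro b ⟨w, hw⟩
    rw [mem_hyperedge] at hw
    exact hw.2 ▸ hW.subset w hw.1 i
  have heq := Set.eq_of_subset_of_ncard_le hsub
    (by rw [hW.full i, Set.ncard_eq_toFinset_card', Set.toFinset_Icc, Nat.card_Icc]; omega)
    (Set.finite_Icc 1 (n i))
  exact heq.symm.subset ⟨h1, h2⟩

/-- A hyperedge covered by two hyperedges of the other colors is a stick. -/
lemma IsBasicLandmarkSystem.stick_of_covered {n : Fin 3 → ℕ} {W : Finset Point}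
    (hW : IsBasicLandmarkSystem n W) {i j k : Fin 3} {a b c : ℕ} (hij : i ≠ j) (hik : i ≠ k)
    (hne : (hyperedge W i a).Nonempty)
    (hcov : ∀ w ∈ W, w i = a → w j = b ∨ w k = c) :
    ∃ w₁ w₂, w₁ ≠ w₂ ∧ hyperedge W i a = {w₁, w₂} ∧ w₁ j = b ∧ w₂ k = c := by
  have h2 := hW.two_le i a hne
  have hJ := hW.inter i j a b hij
  have hK := hW.inter i k a c hik
  have hsub : hyperedge W i a ⊆
      (hyperedge W i a ∩ hyperedge W j b) ∪ (hyperedge W i a ∩ hyperedge W k c) := by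
    intro w hw
    have hw' := mem_hyperedge.mp hw
    simp only [Finset.mem_union, Finset.mem_inter, mem_hyperedge]
    rcases hcov w hw'.1 hw'.2 with h | h
    · exact Or.inl ⟨hw', hw'.1, h⟩
    · exact Or.inr ⟨hw', hw'.1, h⟩
  -- At least two landmarks are covered by two sets of size at most one, so both have size exactly
  -- one.
  have hle := (Finset.card_le_card hsub).trans (Finset.card_union_le _ _)
  obtain ⟨w₁, h1⟩ := Finset.card_eq_one.mp (show (hyperedge W i a ∩ hyperedge W j b).card = 1 by omega)
  obtain ⟨w₂, h2⟩ := Finset.card_eq_one.mp (show (hyperedge W i a ∩ hyperedge W k c).card = 1 by omega)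
  have m1 : w₁ ∈ hyperedge W i a ∩ hyperedge W j b := by simp [h1]
  have m2 : w₂ ∈ hyperedge W i a ∩ hyperedge W k c := by simp [h2]
  rw [Finset.mem_inter, mem_hyperedge, mem_hyperedge] at m1 m2
  rw [h1, h2] at hsub
  have heq : hyperedge W i a = {w₁, w₂} := by
    refine Finset.Subset.antisymm (fun w hw => by simpa using hsub hw) fun w hw => ?_
    rw [Finset.mem_insert, Finset.mem_singleton] at hw
    rcases hw with rfl | rfl
    · exact mem_hyperedge.mpr m1.1
    · exact mem_hyperedge.mpr m2.1
  refine ⟨w₁, w₂, ?_, heq, m1.2.2, m2.2.2⟩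
  rintro rfl
  rw [heq] at h2
  simp_all

lemma exists_other_colors (i : Fin 3) :
    ∃ j k : Fin 3, i ≠ j ∧ i ≠ k ∧ j ≠ k ∧ ∀ l, l = i ∨ l = j ∨ l = k := by
  revert i; decide

/-- If the hyperedge of `x` in color `i` is dominated by the hyperedges of `y`, where `x i ≠ y i`,
then it is a stick, hence pink, and it meets the two other hyperedges of `y`. -/
lemma stick_of_dominated {n : Fin 3 → ℕ} {W : Finset Point}
    (hW : IsBasicLandmarkSystem n W) (hS : SticksArePink W) {x y : Point} {i : Fin 3}
    (h1 : 1 ≤ x i) (h2 : x i ≤ n i) (hxy : x i ≠ y i)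
    (hd : ∀ w ∈ W, (∃ l, w l = x l) → ∃ l, w l = y l) :
    i = 2 ∧ ∃ w₁ w₂, w₁ ≠ w₂ ∧ hyperedge W 2 (x 2) = {w₁, w₂} ∧ w₁ 0 = y 0 ∧ w₂ 1 = y 1 := by
  have hne := hW.nonempty h1 h2
  have cov : ∀ j k : Fin 3, (∀ l, l = i ∨ l = j ∨ l = k) →
      ∀ w ∈ W, w i = x i → w j = y j ∨ w k = y k := by
    intro j k hall w hw hwi
    obtain ⟨l, hl⟩ := hd w hw ⟨i, hwi⟩
    rcases hall l with rfl | rfl | rfl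
    · exact absurd (hwi.symm.trans hl) hxy
    · exact Or.inl hl
    · exact Or.inr hl
  have hi : i = 2 := by
    obtain ⟨j, k, hij, hik, -, hall⟩ := exists_other_colors i
    obtain ⟨w₁, w₂, hne', heq, -⟩ := hW.stick_of_covered hij hik hne (cov j k hall)
    exact hS i (x i) (by rw [heq, Finset.card_pair hne'])
  subst hi
  exact ⟨rfl, hW.stick_of_covered (by decide) (by decide) hne (cov 0 1 (by decide))⟩

/-- Domination works in both directions, so both pink hyperedges are sticks with one end in the
common blue and one in the common green hyperedge. The bad cycle runs pink, green, pink, blue. -/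
lemma eq_of_same_landmarks {n : Fin 3 → ℕ} {W : Finset Point}
    (hW : IsBasicLandmarkSystem n W) (hS : SticksArePink W) (hB : ¬ HasBadFourCycle W)
    {x y : Point} (hx : x ∈ vertexSet n) (hy : y ∈ vertexSet n)
    (h : ∀ w ∈ W, (∃ l, w l = x l) ↔ ∃ l, w l = y l) : x = y := by
  by_contra hne
  have only : ∀ i, x i ≠ y i → i = 2 := fun i hi =>
    (stick_of_dominated hW hS (hx i).1 (hx i).2 hi fun w hw => (h w hw).mp).1
  obtain ⟨i, hi⟩ := Function.ne_iff.mp hne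
  obtain rfl := only i hi
  have h0 : x 0 = y 0 := by
    by_contra h0
    exact absurd (only 0 h0) (by decide)
  have h1 : x 1 = y 1 := by
    by_contra h1
    exact absurd (only 1 h1) (by decide)
  obtain ⟨-, w₁, w₂, h12, e12, hw1, hw2⟩ :=
    stick_of_dominated hW hS (hx 2).1 (hx 2).2 hi fun w hw => (h w hw).mp
  obtain ⟨-, w₄, w₃, h43, e43, hw4, hw3⟩ :=
    stick_of_dominated hW hS (hy 2).1 (hy 2).2 (Ne.symm hi) fun w hw => (h w hw).mpr
  have m1 := mem_hyperedge.mp (show w₁ ∈ hyperedge W 2 (x 2) by simp [e12])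
  have m2 := mem_hyperedge.mp (show w₂ ∈ hyperedge W 2 (x 2) by simp [e12])
  have m3 := mem_hyperedge.mp (show w₃ ∈ hyperedge W 2 (y 2) by simp [e43])
  have m4 := mem_hyperedge.mp (show w₄ ∈ hyperedge W 2 (y 2) by simp [e43])
  have sep : ∀ v w : Point, v 2 = x 2 → w 2 = y 2 → v ≠ w := by
    rintro v w hv hw rfl
    exact hi (hv.symm.trans hw)
  refine hB ⟨w₁, w₂, w₃, w₄, ?_, 2, 1, 0, by decide, by decide, by decide,
    x 2, y 2, y 1, y 0, e12, ?_, by rw [e43, Finset.pair_comm], ?_⟩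
  · simp [h12, h43.symm, sep w₁ w₃ m1.2 m3.2, sep w₁ w₄ m1.2 m4.2, sep w₂ w₃ m2.2 m3.2,
      sep w₂ w₄ m2.2 m4.2]
  · intro w hw
    rw [Finset.mem_insert, Finset.mem_singleton] at hw
    rcases hw with rfl | rfl
    · exact mem_hyperedge.mpr ⟨m2.1, hw2⟩
    · exact mem_hyperedge.mpr ⟨m3.1, hw3.trans h1⟩
  · intro w hw
    rw [Finset.mem_insert, Finset.mem_singleton] at hw
    rcases hw with rfl | rfl
    · exact mem_hyperedge.mpr ⟨m4.1, hw4.trans h0⟩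
    · exact mem_hyperedge.mpr ⟨m1.1, hw1⟩

theorem IsBasicLandmarkSystem.resolvesK {n : Fin 3 → ℕ} {W : Finset Point}
    (hW : IsBasicLandmarkSystem n W) (hS : SticksArePink W) (hB : ¬ HasBadFourCycle W) :
    ResolvesK n W :=
  resolvesK_of_forall hW.subset fun _ hx _ hy _ _ h => eq_of_same_landmarks hW hS hB hx hy h

/-- The case in which `u` shares a coordinate with both points: a coordinate of `x` in which `x`
and `y` differ is a coordinate of `u`. -/
lemma eq_bump_of_ne {n : Fin 3 → ℕ} {W : Finset Point}
    (hW : IsBasicLandmarkSystem n W) (hS : SticksArePink W) {x y : Point}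
    (hx : x ∈ vertexSet (bump n)) (hy : y ∈ vertexSet (bump n))
    (hux : ∃ i, x i = bump n i) (huy : ∃ i, y i = bump n i)
    (h : ∀ w ∈ W, (∃ l, w l = x l) ↔ ∃ l, w l = y l) {i : Fin 3} (hi : x i ≠ y i) :
    x i = bump n i := by
  by_contra hxi
  have hle : x i ≤ n i := by
    have := (hx i).2
    simp only [bump] at this hxi
    omega
  obtain ⟨rfl, w₁, w₂, -, e, hw1, hw2⟩ :=
    stick_of_dominated hW hS (hx i).1 hle hi fun w hw => (h w hw).mp
  have m1 := mem_hyperedge.mp (show w₁ ∈ hyperedge W 2 (x 2) by simp [e])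
  have m2 := mem_hyperedge.mp (show w₂ ∈ hyperedge W 2 (x 2) by simp [e])
  -- The ends of the stick carry the blue and green coordinates of `y`, so these are at most `nᵢ`.
  -- Domination in the reverse direction then makes `x` agree with `y` there, so `u` could share
  -- only its pink coordinate with `x`.
  have hy0 : y 0 ≤ n 0 := hw1 ▸ (hW.subset w₁ m1.1 0).2
  have hy1 : y 1 ≤ n 1 := hw2 ▸ (hW.subset w₂ m2.1 1).2
  have back : ∀ j, y j ≤ n j → x j ≠ y j → j = 2 := fun j hj hne =>
    (stick_of_dominated hW hS (hy j).1 hj hne.symm fun w hw => (h w hw).mpr).1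
  obtain ⟨j, hj⟩ := hux
  have hj' : x j = n j + 1 := hj
  fin_cases j
  · exact absurd (back 0 hy0 (by simp at hj'; omega)) (by decide)
  · exact absurd (back 1 hy1 (by simp at hj'; omega)) (by decide)
  · exact hxi hj

/-- The landmark `u` separates vertices having a new coordinate from those having none. Two vertices
of the first kind can differ only where both equal `u`, which is absurd; two of the second kind lie
in `K(n)`. -/
theorem IsBasicLandmarkSystem.resolvesK_bump {n : Fin 3 → ℕ} {W : Finset Point}
    (hW : IsBasicLandmarkSystem n W) (hS : SticksArePink W) (hB : ¬ HasBadFourCycle W) :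
    ResolvesK (bump n) (insert (bump n) W) := by
  refine resolvesK_of_forall ?_ fun x hx y hy _ _ h => ?_
  · intro w hw i
    rcases Finset.mem_insert.mp hw with rfl | hw
    · simp [bump]
    · have := hW.subset w hw i
      simp only [bump]
      omega
  have hu := h (bump n) (Finset.mem_insert_self _ _)
  have h' : ∀ w ∈ W, (∃ l, w l = x l) ↔ ∃ l, w l = y l := fun w hw =>
    h w (Finset.mem_insert_of_mem hw)
  by_cases hux : ∃ i, bump n i = x i
  · have huy := hu.mp hux
    simp only [eq_comm (a := bump n _)] at hux huy
    funext i
    by_contra hi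
    exact hi ((eq_bump_of_ne hW hS hx hy hux huy h' hi).trans
      (eq_bump_of_ne hW hS hy hx huy hux (fun w hw => (h' w hw).symm) (Ne.symm hi)).symm)
  · have huy := fun h => hux (hu.mpr h)
    have low : ∀ v ∈ vertexSet (bump n), (¬ ∃ i, bump n i = v i) → v ∈ vertexSet n := by
      intro v hv hn i
      have h1 := hv i
      have h2 : bump n i ≠ v i := fun h => hn ⟨i, h⟩
      simp only [bump] at h1 h2
      omega
    exact eq_of_same_landmarks hW hS hB (low x hx hux) (low y hy huy) h'

/-! ### Column systems: incidence conditions on the blue and green rows. -/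

/-- The landmarks are the columns `(bL c, gL c, c)` and `(bL c + 1 mod n₁, gR c, c)`, and the blue
and green rows satisfy the incidence conditions that yield a basic landmark system. -/
structure IsColumnSystem (n : Fin 3 → ℕ) (bL gL gR : ℕ → ℕ) (W : Finset Point) : Prop where
  three_le : 3 ≤ n 0
  mem_iff : ∀ w, w ∈ W ↔ ∃ c, 1 ≤ c ∧ c ≤ n 2 ∧
    (w = ![bL c, gL c, c] ∨ w = ![bL c % n 0 + 1, gR c, c])
  blue_mem : ∀ c, 1 ≤ c → c ≤ n 2 → 1 ≤ bL c ∧ bL c ≤ n 0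
  greenL_mem : ∀ c, 1 ≤ c → c ≤ n 2 → 1 ≤ gL c ∧ gL c ≤ n 1
  greenR_mem : ∀ c, 1 ≤ c → c ≤ n 2 → 1 ≤ gR c ∧ gR c ≤ n 1
  left : ∀ c d, 1 ≤ c → c ≤ n 2 → 1 ≤ d → d ≤ n 2 → bL c = bL d → gL c = gL d → c = d
  right : ∀ c d, 1 ≤ c → c ≤ n 2 → 1 ≤ d → d ≤ n 2 → bL c = bL d → gR c = gR d → c = d
  -- For equal green entries on opposite sides, the three parts control pink-green intersections,
  -- blue-green intersections, and the blue edge that would close a bad 4-cycle through the opposite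
  -- ends of the two sticks.
  cross : ∀ c d, 1 ≤ c → c ≤ n 2 → 1 ≤ d → d ≤ n 2 → gL d = gR c →
    c ≠ d ∧ bL d ≠ bL c % n 0 + 1 ∧ bL c ≠ bL d % n 0 + 1
  blue_count : ∀ a, 1 ≤ a → a ≤ n 0 → 3 ≤ ((Finset.Icc 1 (n 2)).filter fun c => bL c = a).card +
    ((Finset.Icc 1 (n 2)).filter fun c => bL c % n 0 + 1 = a).card
  green_count : ∀ a, 1 ≤ a → a ≤ n 1 → 3 ≤ ((Finset.Icc 1 (n 2)).filter fun c => gL c = a).card +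
    ((Finset.Icc 1 (n 2)).filter fun c => gR c = a).card

lemma cyclic_succ_inj {N a b : ℕ} (ha : 1 ≤ a) (ha' : a ≤ N) (hb : 1 ≤ b) (hb' : b ≤ N)
    (h : a % N + 1 = b % N + 1) : a = b := by
  rcases ha'.lt_or_eq with h1 | rfl <;> rcases hb'.lt_or_eq with h2 | h2
  · rwa [Nat.mod_eq_of_lt h1, Nat.mod_eq_of_lt h2, add_left_inj] at h
  · subst h2
    rw [Nat.mod_eq_of_lt h1, Nat.mod_self] at h
    omega
  · rw [Nat.mod_eq_of_lt h2, Nat.mod_self] at h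
    omega
  · exact h2.symm

lemma cyclic_succ_ne {N a : ℕ} (hN : 2 ≤ N) (ha' : a ≤ N) : a ≠ a % N + 1 := by
  rcases ha'.lt_or_eq with h1 | rfl
  · rw [Nat.mod_eq_of_lt h1]
    omega
  · rw [Nat.mod_self]
    omega

namespace IsColumnSystem

variable {n : Fin 3 → ℕ} {bL gL gR : ℕ → ℕ} {W : Finset Point}

lemma left_mem (h : IsColumnSystem n bL gL gR W) {c : ℕ} (h1 : 1 ≤ c) (h2 : c ≤ n 2) :
    ![bL c, gL c, c] ∈ W := (h.mem_iff _).mpr ⟨c, h1, h2, Or.inl rfl⟩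

lemma right_mem (h : IsColumnSystem n bL gL gR W) {c : ℕ} (h1 : 1 ≤ c) (h2 : c ≤ n 2) :
    ![bL c % n 0 + 1, gR c, c] ∈ W := (h.mem_iff _).mpr ⟨c, h1, h2, Or.inr rfl⟩

lemma subset (h : IsColumnSystem n bL gL gR W) : ∀ w ∈ W, w ∈ vertexSet n := by
  intro w hw i
  obtain ⟨c, h1, h2, rfl | rfl⟩ := (h.mem_iff w).mp hw
  · fin_cases i
    · exact h.blue_mem c h1 h2
    · exact h.greenL_mem c h1 h2
    · exact ⟨h1, h2⟩
  · fin_cases i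
    · exact ⟨Nat.succ_pos _, Nat.mod_lt _ (by have := h.three_le; omega)⟩
    · exact h.greenR_mem c h1 h2
    · exact ⟨h1, h2⟩

lemma bluegreen_inj (h : IsColumnSystem n bL gL gR W) {v w : Point} (hv : v ∈ W) (hw : w ∈ W)
    (h0 : v 0 = w 0) (h1 : v 1 = w 1) : v = w := by
  obtain ⟨c, hc, hc', rfl | rfl⟩ := (h.mem_iff v).mp hv <;>
    obtain ⟨d, hd, hd', rfl | rfl⟩ := (h.mem_iff w).mp hw <;>
    simp only [Matrix.cons_val_zero, Matrix.cons_val_one] at h0 h1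
  · rw [h.left c d hc hc' hd hd' h0 h1]
  · exact absurd h0 (h.cross d c hd hd' hc hc' h1).2.1
  · exact absurd h0.symm (h.cross c d hc hc' hd hd' h1.symm).2.1
  · rw [h.right c d hc hc' hd hd' (cyclic_succ_inj (h.blue_mem c hc hc').1
      (h.blue_mem c hc hc').2 (h.blue_mem d hd hd').1 (h.blue_mem d hd hd').2 h0) h1]

lemma pink_inj (h : IsColumnSystem n bL gL gR W) {v w : Point} (hv : v ∈ W) (hw : w ∈ W)
    (h01 : v 0 = w 0 ∨ v 1 = w 1) (h2 : v 2 = w 2) : v = w := by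
  obtain ⟨c, hc, hc', rfl | rfl⟩ := (h.mem_iff v).mp hv <;>
    obtain ⟨d, hd, hd', rfl | rfl⟩ := (h.mem_iff w).mp hw <;>
    simp only [Matrix.cons_val_zero, Matrix.cons_val_one, Matrix.cons_val] at h01 h2 <;>
    subst h2
  · rfl
  · rcases h01 with h0 | h1
    · exact absurd h0 (cyclic_succ_ne (by have := h.three_le; omega) (h.blue_mem c hc hc').2)
    · exact absurd rfl (h.cross c c hc hc' hc hc' h1).1
  · rcases h01 with h0 | h1
    · exact absurd h0.symm (cyclic_succ_ne (by have := h.three_le; omega) (h.blue_mem c hc hc').2)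
    · exact absurd rfl (h.cross c c hc hc' hc hc' h1.symm).1
  · rfl

lemma inj (h : IsColumnSystem n bL gL gR W) {v w : Point} (hv : v ∈ W) (hw : w ∈ W)
    {i j : Fin 3} (hij : i ≠ j) (hi : v i = w i) (hj : v j = w j) : v = w := by
  fin_cases i <;> fin_cases j
  · exact absurd rfl hij
  · exact h.bluegreen_inj hv hw hi hj
  · exact h.pink_inj hv hw (Or.inl hi) hj
  · exact h.bluegreen_inj hv hw hj hi
  · exact absurd rfl hij
  · exact h.pink_inj hv hw (Or.inr hi) hj
  · exact h.pink_inj hv hw (Or.inl hj) hi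
  · exact h.pink_inj hv hw (Or.inr hj) hi
  · exact absurd rfl hij

lemma left_ne_right (h : IsColumnSystem n bL gL gR W) {c d : ℕ} (h1 : 1 ≤ c) (h2 : c ≤ n 2) :
    (![bL c, gL c, c] : Point) ≠ ![bL d % n 0 + 1, gR d, d] := by
  intro he
  obtain rfl : c = d := congrFun he 2
  exact cyclic_succ_ne (by have := h.three_le; omega) (h.blue_mem c h1 h2).2 (congrFun he 0)

lemma count_le_card (h : IsColumnSystem n bL gL gR W) (i : Fin 3) (a : ℕ) :
    ((Finset.Icc 1 (n 2)).filter fun c => ![bL c, gL c, c] i = a).card +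
      ((Finset.Icc 1 (n 2)).filter fun c => ![bL c % n 0 + 1, gR c, c] i = a).card ≤
    (hyperedge W i a).card := by
  rw [← Finset.card_image_of_injective _
      (show Function.Injective fun c => (![bL c, gL c, c] : Point) from fun c d hcd => congrFun hcd 2),
    ← Finset.card_image_of_injective _
      (show Function.Injective fun c => (![bL c % n 0 + 1, gR c, c] : Point) from
        fun c d hcd => congrFun hcd 2), ← Finset.card_union_of_disjoint]
  · refine Finset.card_le_card fun w hw => ?_
    rw [mem_hyperedge]
    simp only [Finset.mem_union, Finset.mem_image, Finset.mem_filter, Finset.mem_Icc] at hw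
    rcases hw with ⟨c, ⟨⟨h1, h2⟩, hc⟩, rfl⟩ | ⟨c, ⟨⟨h1, h2⟩, hc⟩, rfl⟩
    · exact ⟨h.left_mem h1 h2, hc⟩
    · exact ⟨h.right_mem h1 h2, hc⟩
  · rw [Finset.disjoint_left]
    intro w hw hw'
    simp only [Finset.mem_image, Finset.mem_filter, Finset.mem_Icc] at hw hw'
    obtain ⟨c, ⟨⟨h1, h2⟩, -⟩, rfl⟩ := hw
    obtain ⟨d, -, hd⟩ := hw'
    exact h.left_ne_right h1 h2 hd.symm

lemma blue_card (h : IsColumnSystem n bL gL gR W) {a : ℕ} (h1 : 1 ≤ a) (h2 : a ≤ n 0) :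
    3 ≤ (hyperedge W 0 a).card :=
  (h.blue_count a h1 h2).trans (h.count_le_card 0 a)

lemma green_card (h : IsColumnSystem n bL gL gR W) {a : ℕ} (h1 : 1 ≤ a) (h2 : a ≤ n 1) :
    3 ≤ (hyperedge W 1 a).card :=
  (h.green_count a h1 h2).trans (h.count_le_card 1 a)

lemma pink_hyperedge (h : IsColumnSystem n bL gL gR W) {c : ℕ} (h1 : 1 ≤ c) (h2 : c ≤ n 2) :
    hyperedge W 2 c = {![bL c, gL c, c], ![bL c % n 0 + 1, gR c, c]} := by
  ext w
  rw [mem_hyperedge, h.mem_iff, Finset.mem_insert, Finset.mem_singleton]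
  constructor
  · rintro ⟨⟨d, -, -, rfl | rfl⟩, rfl⟩
    · exact Or.inl rfl
    · exact Or.inr rfl
  · rintro (rfl | rfl)
    · exact ⟨⟨c, h1, h2, Or.inl rfl⟩, rfl⟩
    · exact ⟨⟨c, h1, h2, Or.inr rfl⟩, rfl⟩

lemma pink_card (h : IsColumnSystem n bL gL gR W) {c : ℕ} (h1 : 1 ≤ c) (h2 : c ≤ n 2) :
    (hyperedge W 2 c).card = 2 := by
  rw [h.pink_hyperedge h1 h2, Finset.card_pair (h.left_ne_right h1 h2)]

lemma two_le_card (h : IsColumnSystem n bL gL gR W) (i : Fin 3) {a : ℕ} (h1 : 1 ≤ a)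
    (h2 : a ≤ n i) : 2 ≤ (hyperedge W i a).card := by
  fin_cases i
  · exact (h.blue_card h1 h2).trans' (by norm_num)
  · exact (h.green_card h1 h2).trans' (by norm_num)
  · exact (h.pink_card h1 h2).ge

lemma mem_Icc_of_nonempty (h : IsColumnSystem n bL gL gR W) {i : Fin 3} {a : ℕ}
    (hne : (hyperedge W i a).Nonempty) : 1 ≤ a ∧ a ≤ n i := by
  obtain ⟨w, hw⟩ := hne
  rw [mem_hyperedge] at hw
  exact hw.2 ▸ h.subset w hw.1 i

theorem isBasicLandmarkSystem (h : IsColumnSystem n bL gL gR W) : IsBasicLandmarkSystem n W where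
  subset := h.subset
  full i := by
    have : {a : ℕ | (hyperedge W i a).Nonempty} = Set.Icc 1 (n i) := by
      ext a
      refine ⟨h.mem_Icc_of_nonempty, fun ha => ?_⟩
      exact Finset.card_pos.mp ((h.two_le_card i ha.1 ha.2).trans' (by norm_num))
    rw [this, Set.ncard_eq_toFinset_card', Set.toFinset_Icc, Nat.card_Icc, Nat.add_sub_cancel]
  two_le i a hne := h.two_le_card i (h.mem_Icc_of_nonempty hne).1 (h.mem_Icc_of_nonempty hne).2
  inter i j a b hij := by
    refine Finset.card_le_one.mpr fun v hv w hw => ?_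
    rw [Finset.mem_inter, mem_hyperedge, mem_hyperedge] at hv hw
    exact h.inj hv.1.1 hw.1.1 hij (hv.1.2.trans hw.1.2.symm) (hv.2.2.trans hw.2.2.symm)

theorem sticksArePink (h : IsColumnSystem n bL gL gR W) : SticksArePink W := by
  intro i a hc
  have hr := h.mem_Icc_of_nonempty (i := i) (a := a) (Finset.card_pos.mp (by omega))
  fin_cases i
  · have := h.blue_card hr.1 hr.2
    simp at hc
    omega
  · have := h.green_card hr.1 hr.2
    simp at hc
    omega
  · rfl

/-- In a 4-cycle with two pink sticks, the green and blue edges cannot both join sides of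
different pink sticks: neither on the same side nor across. -/
lemma no_cycle (h : IsColumnSystem n bL gL gR W) {v₁ v₂ v₃ v₄ : Point} {a b : ℕ}
    (h12 : hyperedge W 2 a = {v₁, v₂}) (h34 : hyperedge W 2 b = {v₃, v₄}) (hne : v₂ ≠ v₃)
    (hg : v₂ 1 = v₃ 1) (hb : v₁ 0 = v₄ 0) : False := by
  have ra := h.mem_Icc_of_nonempty (i := 2) (a := a) (by rw [h12]; simp)
  have rb := h.mem_Icc_of_nonempty (i := 2) (a := b) (by rw [h34]; simp)
  have m2 : v₂ ∈ W := (mem_hyperedge.mp (show v₂ ∈ hyperedge W 2 a by simp [h12])).1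
  have m3 : v₃ ∈ W := (mem_hyperedge.mp (show v₃ ∈ hyperedge W 2 b by simp [h34])).1
  have pair : ∀ {p q v w : Point}, ({p, q} : Finset Point) = {v, w} → p ≠ q →
      (v = p ∧ w = q) ∨ (v = q ∧ w = p) := by
    intro p q v w he hpq
    have hp : p ∈ ({v, w} : Finset Point) := by simp [← he]
    have hq : q ∈ ({v, w} : Finset Point) := by simp [← he]
    rw [Finset.mem_insert, Finset.mem_singleton] at hp hq
    rcases hp with rfl | rfl <;> rcases hq with rfl | rfl <;> simp_all
  rw [h.pink_hyperedge ra.1 ra.2] at h12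
  rw [h.pink_hyperedge rb.1 rb.2] at h34
  have ba := h.blue_mem a ra.1 ra.2
  have bb := h.blue_mem b rb.1 rb.2
  refine absurd ?_ hne
  -- If the green edge crosses sides, so does the blue one, and `cross` excludes it. If it stays on
  -- one side, the blue edge joins the opposite ends on the other side; as the cyclic shift is
  -- injective, the green edge's ends also share their blue entry and coincide.
  rcases pair h12 (h.left_ne_right ra.1 ra.2) with ⟨rfl, rfl⟩ | ⟨rfl, rfl⟩ <;>
    rcases pair h34 (h.left_ne_right rb.1 rb.2) with ⟨rfl, rfl⟩ | ⟨rfl, rfl⟩ <;>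
    simp only [Matrix.cons_val_zero, Matrix.cons_val_one] at hg hb
  · exact absurd hb (h.cross a b ra.1 ra.2 rb.1 rb.2 hg.symm).2.2
  · exact h.bluegreen_inj m2 m3 (by simp [hb]) (by simpa using hg)
  · refine h.bluegreen_inj m2 m3 ?_ (by simpa using hg)
    simpa using cyclic_succ_inj ba.1 ba.2 bb.1 bb.2 hb
  · exact absurd hb.symm (h.cross b a rb.1 rb.2 ra.1 ra.2 hg).2.2

theorem not_hasBadFourCycle (h : IsColumnSystem n bL gL gR W) : ¬ HasBadFourCycle W := by
  rintro ⟨w₁, w₂, w₃, w₄, hnd, i, j, k, hij, hik, hjk, a, b, c, d, h12, h23, h34, h41⟩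
  simp only [List.nodup_cons, List.mem_cons, List.not_mem_nil, or_false, not_or] at hnd
  obtain rfl : i = 2 := h.sticksArePink i a (by rw [h12, Finset.card_pair hnd.1.1])
  have e2 := mem_hyperedge.mp (h23 (Finset.mem_insert_self _ _))
  have e3 := mem_hyperedge.mp (h23 (Finset.mem_insert_of_mem (Finset.mem_singleton_self _)))
  have e4 := mem_hyperedge.mp (h41 (Finset.mem_insert_self _ _))
  have e1 := mem_hyperedge.mp (h41 (Finset.mem_insert_of_mem (Finset.mem_singleton_self _)))
  have e23 := e2.2.trans e3.2.symm
  have e14 := e1.2.trans e4.2.symm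
  have hjk' : (j = 1 ∧ k = 0) ∨ (j = 0 ∧ k = 1) := by
    revert hij hik hjk
    clear * -
    revert j k
    decide
  rcases hjk' with ⟨rfl, rfl⟩ | ⟨rfl, rfl⟩
  · exact h.no_cycle h12 h34 hnd.2.1.1 e23 e14
  -- With blue and green exchanged, reversing both sticks restores the pattern of `no_cycle`.
  · exact h.no_cycle (h12.trans (Finset.pair_comm _ _)) (h34.trans (Finset.pair_comm _ _))
      hnd.1.2.2 e14 e23

end IsColumnSystem

/-! ### Multiplicities and blue blocks -/

lemma blockStart_one (n : Fin 3 → ℕ) : blockStart n 1 = 1 := by simp [blockStart]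

lemma blockStart_succ (n : Fin 3 → ℕ) {i : ℕ} (hi : 1 ≤ i) :
    blockStart n (i + 1) = blockStart n i + mult n i := by
  rw [blockStart, Finset.sum_Ico_succ_top hi, blockStart, add_assoc]

/-- Each of the first `k` blocks contributes `q`; the last summand counts the blocks of length `q +
1` among them, namely the odd ones in the alternating part and possibly the whole tail. -/
lemma blockStart_add_one_eq (n : Fin 3 → ℕ) (k : ℕ) :
    blockStart n (k + 1) = 1 + n 2 / n 0 * k +
      (if k ≤ 2 * min (n 2 % n 0) (n 0 - n 2 % n 0) then (k + 1) / 2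
       else min (n 2 % n 0) (n 0 - n 2 % n 0) +
        if n 2 % n 0 ≤ n 0 - n 2 % n 0 then 0
        else k - 2 * min (n 2 % n 0) (n 0 - n 2 % n 0)) := by
  induction k with
  | zero => simp [blockStart]
  | succ k ih =>
    rw [blockStart_succ n (Nat.succ_pos k), ih, mult]
    generalize n 2 / n 0 = q
    generalize n 2 % n 0 = r
    generalize n 0 - r = s
    rw [Nat.mul_succ]
    split_ifs <;> omega

/-- Equivalently, the multiplicities sum to `n₃`: exactly `r` of them are `q + 1`. -/
lemma blockStart_end (n : Fin 3 → ℕ) (h0 : 0 < n 0) : blockStart n (n 0 + 1) = n 2 + 1 := by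
  rw [blockStart_add_one_eq]
  have h1 := Nat.div_add_mod' (n 2) (n 0)
  have h2 := Nat.mod_lt (n 2) h0
  split_ifs <;> omega

lemma blockStart_mono (n : Fin 3 → ℕ) : Monotone (blockStart n) := by
  intro i j hij
  unfold blockStart
  gcongr

/-- `blueL n c` is the index of the blue block containing column `c`. -/
lemma blueL_eq {n : Fin 3 → ℕ} {b c : ℕ} (hb' : b ≤ n 0)
    (h1 : blockStart n b ≤ c) (h2 : c < blockStart n (b + 1)) : blueL n c = b := by
  have : (Finset.Icc 1 (n 0)).filter (fun i => blockStart n i ≤ c) = Finset.Icc 1 b := by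
    ext i
    simp only [Finset.mem_filter, Finset.mem_Icc]
    constructor
    · rintro ⟨⟨hi, -⟩, hc⟩
      refine ⟨hi, ?_⟩
      by_contra! hlt
      have := blockStart_mono n (show b + 1 ≤ i from hlt)
      omega
    · rintro ⟨hi, hib⟩
      exact ⟨⟨hi, hib.trans hb'⟩, (blockStart_mono n hib).trans h1⟩
  rw [blueL, this, Nat.card_Icc, Nat.add_sub_cancel]

lemma exists_block {n : Fin 3 → ℕ} {c : ℕ} (h1 : 1 ≤ c) (k : ℕ) (h2 : c < blockStart n (k + 1)) :
    ∃ b, 1 ≤ b ∧ b ≤ k ∧ blockStart n b ≤ c ∧ c < blockStart n (b + 1) := by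
  induction k with
  | zero =>
    rw [zero_add, blockStart_one] at h2
    omega
  | succ k ih =>
    by_cases h : c < blockStart n (k + 1)
    · obtain ⟨b, hb1, hb2, hb⟩ := ih h
      exact ⟨b, hb1, hb2.trans (Nat.le_succ k), hb⟩
    · exact ⟨k + 1, Nat.succ_pos k, le_rfl, not_lt.mp h, h2⟩

lemma blueL_spec {n : Fin 3 → ℕ} (h0 : 0 < n 0) {c : ℕ} (h1 : 1 ≤ c) (h2 : c ≤ n 2) :
    1 ≤ blueL n c ∧ blueL n c ≤ n 0 ∧ blockStart n (blueL n c) ≤ c ∧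
      c < blockStart n (blueL n c + 1) := by
  obtain ⟨b, hb1, hb2, hb3, hb4⟩ := exists_block (n := n) h1 (n 0)
    (by rw [blockStart_end n h0]; omega)
  rw [blueL_eq hb2 hb3 hb4]
  exact ⟨hb1, hb2, hb3, hb4⟩

namespace MiddleCone

variable {n : Fin 3 → ℕ}

lemma fst_pos (hn : MiddleCone n) : 0 < n 0 := by have := hn.three_le_fst; omega

lemma one_le_div (hn : MiddleCone n) : 1 ≤ n 2 / n 0 :=
  (Nat.one_le_div_iff hn.fst_pos).mpr hn.fst_le

lemma one_le_mult (hn : MiddleCone n) (i : ℕ) : 1 ≤ mult n i := by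
  have := hn.one_le_div
  simp only [mult]
  split_ifs <;> omega

/-- If the quotient is `1`, then at least half of the multiplicities are `2`. -/
lemma le_two_mul_mod (hn : MiddleCone n) (hq : n 2 / n 0 = 1) : n 0 ≤ 2 * (n 2 % n 0) := by
  have h1 := Nat.div_add_mod' (n 2) (n 0)
  have h2 := hn.lower
  rw [hq] at h1
  omega

/-- If `q = 1`, then `0 < r < n₁`, so the alternating part is nonempty and begins with `q + 1`. -/
lemma two_le_mult_one (hn : MiddleCone n) : 2 ≤ mult n 1 := by
  have h1 := hn.one_le_div
  have h2 := hn.le_two_mul_mod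
  have h3 := hn.three_le_fst
  have h4 := Nat.mod_lt (n 2) hn.fst_pos
  simp only [mult]
  split_ifs <;> omega

/-- For `q = 1` at least half the blocks have length `2`, so the tail, if any, consists of twos and
no two ones are consecutive. -/
lemma three_le_mult_add_mult (hn : MiddleCone n) {a : ℕ} (ha : a < n 0) :
    3 ≤ mult n a + mult n (a + 1) := by
  have h1 := hn.one_le_div
  have h2 := hn.le_two_mul_mod
  have h4 := Nat.mod_lt (n 2) hn.fst_pos
  simp only [mult]
  split_ifs <;> omega

lemma mult_le_half_of_even (hn : MiddleCone n) (he : Even (n 1)) {i : ℕ} (hi : 1 ≤ i) :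
    mult n i ≤ half n := by
  have h1 := Nat.div_add_mod' (n 2) (n 0)
  have h4 := Nat.mod_lt (n 2) hn.fst_pos
  have hf : n 1 = 2 * half n := (Nat.two_mul_div_two_of_even he).symm
  have h5 : n 2 ≤ half n * n 0 := by
    have := hn.upper
    rw [hf] at this
    nlinarith
  have h6 : n 2 / n 0 ≤ half n := Nat.div_le_of_le_mul (by rwa [mul_comm])
  have h7 : n 2 / n 0 = half n → n 2 % n 0 = 0 := by
    intro h
    rw [h] at h1
    omega
  simp only [mult]
  split_ifs <;> omega

lemma snd_eq_of_odd (ho : Odd (n 1)) : n 1 = 2 * half n + 1 :=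
  (Nat.two_mul_div_two_add_one_of_odd ho).symm

/-- The average multiplicity `n₃ / n₁` is at most `f + 1/2`. Hence at most half of the blocks can be
long, which is what allows them to alternate with shorter ones. -/
lemma div_le_half (hn : MiddleCone n) (ho : Odd (n 1)) : n 2 / n 0 ≤ half n ∧
    (n 2 / n 0 = half n → 2 * (n 2 % n 0) ≤ n 0) := by
  have h1 := Nat.div_add_mod' (n 2) (n 0)
  have h3 := hn.upper
  have h0 := hn.fst_pos
  rw [snd_eq_of_odd ho] at h3
  have h5 : 2 * n 2 ≤ 2 * (half n * n 0) + n 0 := by nlinarith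
  constructor
  · by_contra! h
    have : (half n + 1) * n 0 ≤ n 2 / n 0 * n 0 := Nat.mul_le_mul_right _ h
    rw [Nat.succ_mul] at this
    omega
  · intro h
    rw [h] at h1
    omega

lemma mult_le_half_add_one (hn : MiddleCone n) (ho : Odd (n 1)) (i : ℕ) :
    mult n i ≤ half n + 1 := by
  have h1 := hn.div_le_half ho
  simp only [mult]
  split_ifs <;> omega

/-- The multiplicities exceeding `f` are `f + 1`, and they alternate with multiplicities `f`. -/
lemma half_lt_mult_iff (hn : MiddleCone n) (ho : Odd (n 1)) (i : ℕ) :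
    half n < mult n i ↔ n 2 / n 0 = half n ∧ i ≤ 2 * (n 2 % n 0) ∧ i % 2 = 1 := by
  have h1 := hn.div_le_half ho
  have h4 := Nat.mod_lt (n 2) hn.fst_pos
  simp only [mult]
  split_ifs <;> omega

lemma mem_longBlocks {i : ℕ} : i ∈ longBlocks n ↔ (1 ≤ i ∧ i ≤ n 0) ∧ half n < mult n i := by
  simp [longBlocks]

lemma longBlocks_not_adjacent (hn : MiddleCone n) (ho : Odd (n 1)) {i j : ℕ}
    (hi : i ∈ longBlocks n) (hj : j ∈ longBlocks n) : j ≠ i % n 0 + 1 := by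
  rw [mem_longBlocks] at hi hj
  have h1 := hn.div_le_half ho
  have h2 := (hn.half_lt_mult_iff ho i).mp hi.2
  have h3 := (hn.half_lt_mult_iff ho j).mp hj.2
  rcases hi.1.2.lt_or_eq with h | h
  · rw [Nat.mod_eq_of_lt h]
    omega
  -- At the wrap-around, `n₁` itself would be odd and at most `2r ≤ n₁`, forcing the contradiction
  -- `n₁ = 2r`.
  · rw [h, Nat.mod_self]
    omega

/-- The alternating pattern starts with its larger value, so block `1` is long as soon as any block
is. -/
lemma eq_one_of_mem_longBlocks (hn : MiddleCone n) (ho : Odd (n 1))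
    (hc : (longBlocks n).card ≤ 1) {i : ℕ} (hi : i ∈ longBlocks n) : i = 1 := by
  refine Finset.card_le_one.mp hc i hi 1 ?_
  rw [mem_longBlocks] at hi ⊢
  have h2 := (hn.half_lt_mult_iff ho i).mp hi.2
  exact ⟨⟨le_rfl, hn.fst_pos⟩, (hn.half_lt_mult_iff ho 1).mpr ⟨h2.1, by omega, rfl⟩⟩

/-- A long block occurs only if all multiplicities are at least `f`. -/
lemma half_mul_add_card_le (hn : MiddleCone n) (ho : Odd (n 1)) (hne : (longBlocks n).Nonempty) :
    half n * n 0 + (longBlocks n).card ≤ n 2 := by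
  obtain ⟨i, hi⟩ := hne
  rw [mem_longBlocks] at hi
  have hq := ((hn.half_lt_mult_iff ho i).mp hi.2).1
  have hsum : ∑ j ∈ Finset.Icc 1 (n 0), mult n j = n 2 := by
    have := blockStart_end n hn.fst_pos
    rw [blockStart, add_comm, add_left_inj] at this
    exact this
  have hge : ∀ j ∈ Finset.Icc 1 (n 0), half n + (if half n < mult n j then 1 else 0) ≤ mult n j := by
    intro j _
    have : half n ≤ mult n j := by
      rw [← hq]
      simp only [mult]
      split_ifs <;> omega
    split_ifs <;> omega
  have := Finset.sum_le_sum hge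
  rw [hsum, Finset.sum_add_distrib, Finset.sum_const, Nat.card_Icc, smul_eq_mul,
    ← Finset.card_filter, Nat.add_sub_cancel, mul_comm] at this
  exact this

end MiddleCone

/-! ### Periodic rows with insertions -/

/-- The number of columns before `c` that are not insertions, i.e. the index of the periodic entry
in column `c`. -/
def periodicIndex (P : Finset ℕ) (c : ℕ) : ℕ := (Finset.Ico 1 c \ P).card

lemma insertedRow_of_mem {f s v : ℕ} {P : Finset ℕ} {c : ℕ} (hc : c ∈ P) :
    insertedRow f s v P c = v := if_pos hc

lemma insertedRow_of_notMem {f s v : ℕ} {P : Finset ℕ} (hP : ∀ p ∈ P, 1 ≤ p) {c : ℕ}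
    (hc : c ∉ P) : insertedRow f s v P c = s + periodicIndex P c % f + 1 := by
  have : P.filter (· < c) = P ∩ Finset.Ico 1 c := by
    ext p
    simp only [Finset.mem_filter, Finset.mem_inter, Finset.mem_Ico]
    exact ⟨fun h => ⟨h.1, hP p h.1, h.2⟩, fun h => ⟨h.1, h.2.2⟩⟩
  rw [insertedRow, if_neg hc, periodicIndex, Finset.card_sdiff, this, Nat.card_Ico]

lemma insertedRow_mem_Icc {f s v : ℕ} {P : Finset ℕ} (hP : ∀ p ∈ P, 1 ≤ p) (hf : 0 < f) {c : ℕ}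
    (hc : c ∉ P) : s + 1 ≤ insertedRow f s v P c ∧ insertedRow f s v P c ≤ s + f := by
  rw [insertedRow_of_notMem hP hc]
  have := Nat.mod_lt (periodicIndex P c) hf
  omega

lemma periodicIndex_add {P : Finset ℕ} {c d : ℕ} (hc : 1 ≤ c) (hcd : c ≤ d) :
    periodicIndex P c + (Finset.Ico c d \ P).card = periodicIndex P d := by
  rw [periodicIndex, periodicIndex, ← Finset.Ico_union_Ico_eq_Ico hc hcd,
    Finset.union_sdiff_distrib, Finset.card_union_of_disjoint]
  exact (Finset.Ico_disjoint_Ico_consecutive 1 c d).mono Finset.sdiff_subset Finset.sdiff_subset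

/-- Two periodic entries in an interval with at most `f` periodic entries are different. -/
lemma periodicIndex_mod_ne {P : Finset ℕ} {f a b c d : ℕ} (hf : (Finset.Ico a b \ P).card ≤ f)
    (h1 : 1 ≤ c) (hac : a ≤ c) (hcd : c < d) (hdb : d < b) (hc : c ∉ P) (hd : d ∉ P) :
    periodicIndex P c % f ≠ periodicIndex P d % f := by
  have hadd := periodicIndex_add (P := P) h1 hcd.le
  have hpos : 0 < (Finset.Ico c d \ P).card :=
    Finset.card_pos.mpr ⟨c, by simp [hc, hcd]⟩
  have hlt : (Finset.Ico c d \ P).card < (Finset.Ico a b \ P).card := by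
    refine Finset.card_lt_card (Finset.ssubset_iff_of_subset ?_ |>.mpr ⟨d, ?_, ?_⟩)
    · exact Finset.sdiff_subset_sdiff (Finset.Ico_subset_Ico hac hdb.le) subset_rfl
    · simp [hd, hdb, hac.trans hcd.le]
    · simp
  intro he
  have hdvd : f ∣ periodicIndex P d - periodicIndex P c :=
    (Nat.modEq_iff_dvd' (by omega)).mp he
  have := Nat.le_of_dvd (by omega) hdvd
  omega

/-- The interval has at most `f` consecutive periodic entries and at most one insertion, whose value
exceeds them all. The bound on `v` is asked only if there are insertions, because `v = 2f` when `n₂`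
is even. -/
lemma insertedRow_ne {P : Finset ℕ} {f s v a b c d : ℕ} (hP : ∀ p ∈ P, 1 ≤ p) (hf0 : 0 < f)
    (hf : (Finset.Ico a b \ P).card ≤ f) (hv : ∀ p ∈ P, s + f < v)
    (hone : ∀ p ∈ P, ∀ p' ∈ P, a ≤ p → p < b → a ≤ p' → p' < b → p = p')
    (h1 : 1 ≤ c) (hac : a ≤ c) (hcd : c < d) (hdb : d < b) :
    insertedRow f s v P c ≠ insertedRow f s v P d := by
  by_cases hc : c ∈ P <;> by_cases hd : d ∈ P
  · exact absurd (hone c hc d hd hac (hcd.trans hdb) (hac.trans hcd.le) hdb) hcd.ne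
  · have := hv c hc
    have := insertedRow_mem_Icc (s := s) (v := v) hP hf0 hd
    rw [insertedRow_of_mem hc]
    omega
  · have := hv d hd
    have := insertedRow_mem_Icc (s := s) (v := v) hP hf0 hc
    rw [insertedRow_of_mem hd]
    omega
  · have := periodicIndex_mod_ne hf h1 hac hcd hdb hc hd
    rw [insertedRow_of_notMem hP hc, insertedRow_of_notMem hP hd]
    omega

/-- The index grows by one after each periodic column and stays constant across insertions, so no
value is skipped. -/
lemma exists_periodicIndex_eq (P : Finset ℕ) (N : ℕ) {k : ℕ}
    (hk : k < (Finset.Icc 1 N \ P).card) :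
    ∃ c, 1 ≤ c ∧ c ≤ N ∧ c ∉ P ∧ periodicIndex P c = k := by
  induction N with
  | zero => simp at hk
  | succ N ih =>
    by_cases h : k < (Finset.Icc 1 N \ P).card
    · obtain ⟨c, h1, h2, h3⟩ := ih h
      exact ⟨c, h1, h2.trans (Nat.le_succ N), h3⟩
    · rw [← Finset.insert_Icc_right_eq_Icc_add_one (by omega)] at hk
      by_cases hN : N + 1 ∈ P
      · rw [Finset.insert_sdiff_of_mem _ hN] at hk
        exact absurd hk h
      · rw [Finset.insert_sdiff_of_notMem _ hN, Finset.card_insert_of_notMem (by simp)] at hk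
        refine ⟨N + 1, by omega, le_rfl, hN, ?_⟩
        have : Finset.Ico 1 (N + 1) = Finset.Icc 1 N := by ext; simp
        rw [periodicIndex, this]
        omega

/-- Each periodic entry occurs about once in `f` periodic columns. -/
lemma le_card_insertedRow_eq {P : Finset ℕ} {f s v N j K : ℕ} (hP : ∀ p ∈ P, 1 ≤ p) (hj : j < f)
    (hK : ∀ t < K, j + f * t < (Finset.Icc 1 N \ P).card) :
    K ≤ ((Finset.Icc 1 N).filter fun c => insertedRow f s v P c = s + j + 1).card := by
  -- The entry in question sits in the columns of periodic index `j`, `j + f`, `j + 2f`, and so on.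
  choose! col h1 h2 h3 h4 using fun t ht => exists_periodicIndex_eq P N (hK t ht)
  rw [← Finset.card_range K]
  refine Finset.card_le_card_of_injOn col ?_ ?_
  · intro t ht
    have ht := Finset.mem_range.mp ht
    refine Finset.mem_coe.mpr (Finset.mem_filter.mpr ⟨Finset.mem_Icc.mpr ⟨h1 t ht, h2 t ht⟩, ?_⟩)
    rw [insertedRow_of_notMem hP (h3 t ht), h4 t ht, Nat.add_mul_mod_self_left,
      Nat.mod_eq_of_lt hj]
  · intro t ht u hu htu
    have ht := h4 t (Finset.mem_range.mp ht)
    have hu := h4 u (Finset.mem_range.mp hu)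
    rw [← htu, ht, add_right_inj] at hu
    exact Nat.eq_of_mul_eq_mul_left (by omega) hu

/-! ### The insertions in the construction -/

/-- The blue blocks that contain a pair of neutrals at their start. -/
def insertBlocks (n : Fin 3 → ℕ) : Finset ℕ :=
  if Even (n 1) then ∅ else if 1 < (longBlocks n).card then longBlocks n else {1}

/-- The columns of the neutrals on the left (`e = 0`) and on the right (`e = 1`). -/
def neutralColumns (n : Fin 3 → ℕ) (e : ℕ) : Finset ℕ :=
  (insertBlocks n).image fun i => blockStart n i + e

lemma insertPositions_eq (n : Fin 3 → ℕ) : insertPositions n = neutralColumns n 0 := by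
  unfold insertPositions neutralColumns insertBlocks
  split_ifs <;> simp [blockStart_one]

lemma image_insertPositions_eq (n : Fin 3 → ℕ) :
    (insertPositions n).image (· + 1) = neutralColumns n 1 := by
  rw [insertPositions_eq, neutralColumns, neutralColumns, Finset.image_image]
  rfl

lemma mem_neutralColumns {n : Fin 3 → ℕ} {e c : ℕ} :
    c ∈ neutralColumns n e ↔ ∃ i ∈ insertBlocks n, blockStart n i + e = c := by
  simp [neutralColumns]

lemma one_le_of_mem_neutralColumns {n : Fin 3 → ℕ} {e c : ℕ} (hc : c ∈ neutralColumns n e) :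
    1 ≤ c := by
  obtain ⟨i, -, rfl⟩ := mem_neutralColumns.mp hc
  simp only [blockStart]
  omega

namespace MiddleCone

variable {n : Fin 3 → ℕ}

lemma half_pos (hn : MiddleCone n) : 0 < half n := by
  have := hn.three_le_snd
  simp only [half]
  omega

lemma odd_of_mem_insertBlocks {i : ℕ} (hi : i ∈ insertBlocks n) : Odd (n 1) := by
  unfold insertBlocks at hi
  split_ifs at hi with h1
  · simp at hi
  · exact Nat.not_even_iff_odd.mp h1
  · exact Nat.not_even_iff_odd.mp h1

/-- Length at least two keeps the right neutral, one column after the start, in the same block as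
the left one. -/
lemma mem_insertBlocks_bounds (hn : MiddleCone n) {i : ℕ} (hi : i ∈ insertBlocks n) :
    1 ≤ i ∧ i ≤ n 0 ∧ 2 ≤ mult n i := by
  have := hn.half_pos
  unfold insertBlocks at hi
  split_ifs at hi with h1 h2
  · simp at hi
  · have h := mem_longBlocks.mp hi
    omega
  · rw [Finset.mem_singleton] at hi
    subst hi
    exact ⟨le_rfl, hn.fst_pos, hn.two_le_mult_one⟩

lemma insertBlocks_not_adjacent (hn : MiddleCone n) {i j : ℕ} (hi : i ∈ insertBlocks n)
    (hj : j ∈ insertBlocks n) : j ≠ i % n 0 + 1 := by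
  have ho := odd_of_mem_insertBlocks hi
  unfold insertBlocks at hi hj
  split_ifs at hi hj with h1 h2
  · simp at hi
  · exact hn.longBlocks_not_adjacent ho hi hj
  · rw [Finset.mem_singleton] at hi hj
    subst hi hj
    exact cyclic_succ_ne (by have := hn.three_le_fst; omega) hn.fst_pos

/-- A unique long block must be block `1`, which is where the pair is inserted in that case. -/
lemma mem_insertBlocks_of_half_lt (hn : MiddleCone n) {i : ℕ} (h1 : 1 ≤ i) (h2 : i ≤ n 0)
    (hi : half n < mult n i) : i ∈ insertBlocks n ∧ mult n i = half n + 1 := by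
  have hl := mem_longBlocks.mpr ⟨⟨h1, h2⟩, hi⟩
  unfold insertBlocks
  split_ifs with he hc
  · exact absurd hi (hn.mult_le_half_of_even he h1).not_gt
  · have := hn.mult_le_half_add_one (Nat.not_even_iff_odd.mp he) i
    exact ⟨hl, by omega⟩
  · have ho := Nat.not_even_iff_odd.mp he
    have := hn.mult_le_half_add_one ho i
    exact ⟨Finset.mem_singleton.mpr (hn.eq_one_of_mem_longBlocks ho (not_lt.mp hc) hl), by omega⟩

lemma three_mul_half_add_two_le (hn : MiddleCone n) (ho : Odd (n 1)) : 3 * half n + 2 ≤ n 2 := by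
  have h1 := snd_eq_of_odd ho
  have h2 := hn.lower
  omega

/-- This leaves at least `3f` periodic columns on each side. With several long blocks it holds
because all `n₁ ≥ 3` blocks have length at least `f` and the long ones have one column more. -/
lemma three_mul_half_add_card_le (hn : MiddleCone n) :
    3 * half n + (insertBlocks n).card ≤ n 2 := by
  unfold insertBlocks
  split_ifs with he hc
  · have := Nat.two_mul_div_two_of_even he
    have := hn.lower
    simp only [half, Finset.card_empty]
    omega
  · have h1 := hn.half_mul_add_card_le (Nat.not_even_iff_odd.mp he)
      (Finset.card_pos.mp (by omega))
    have := Nat.mul_le_mul_left (half n) hn.three_le_fst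
    omega
  · have := hn.three_mul_half_add_two_le (Nat.not_even_iff_odd.mp he)
    rw [Finset.card_singleton]
    omega

lemma mem_neutralColumns_bounds (hn : MiddleCone n) {e i : ℕ} (he : e ≤ 1)
    (hi : i ∈ insertBlocks n) :
    blockStart n i + e < blockStart n (i + 1) ∧ blueL n (blockStart n i + e) = i ∧
      blockStart n i + e ≤ n 2 := by
  obtain ⟨h1, h2, h3⟩ := hn.mem_insertBlocks_bounds hi
  have hs := blockStart_succ n h1
  refine ⟨by omega, blueL_eq h2 (by omega) (by omega), ?_⟩
  have := blockStart_mono n (Nat.succ_le_succ h2)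
  rw [Nat.succ_eq_add_one, Nat.succ_eq_add_one, blockStart_end n hn.fst_pos] at this
  omega

lemma card_neutralColumns (hn : MiddleCone n) {e : ℕ} (he : e ≤ 1) :
    (neutralColumns n e).card = (insertBlocks n).card := by
  refine Finset.card_image_of_injOn fun i hi j hj hij => ?_
  rw [← (hn.mem_neutralColumns_bounds he hi).2.1, ← (hn.mem_neutralColumns_bounds he hj).2.1]
  exact congrArg _ hij

lemma neutralColumns_subset (hn : MiddleCone n) {e : ℕ} (he : e ≤ 1) :
    neutralColumns n e ⊆ Finset.Icc 1 (n 2) := by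
  intro c hc
  rw [Finset.mem_Icc]
  refine ⟨one_le_of_mem_neutralColumns hc, ?_⟩
  obtain ⟨i, hi, rfl⟩ := mem_neutralColumns.mp hc
  exact (hn.mem_neutralColumns_bounds he hi).2.2

lemma card_sdiff_neutralColumns (hn : MiddleCone n) {e : ℕ} (he : e ≤ 1) :
    (Finset.Icc 1 (n 2) \ neutralColumns n e).card = n 2 - (insertBlocks n).card := by
  rw [Finset.card_sdiff_of_subset (hn.neutralColumns_subset he), hn.card_neutralColumns he,
    Nat.card_Icc, Nat.add_sub_cancel]

/-- Every blue block contains at most `f` periodic green entries. -/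
lemma card_block_sdiff_le (hn : MiddleCone n) {e b : ℕ} (he : e ≤ 1) (h1 : 1 ≤ b)
    (h2 : b ≤ n 0) :
    (Finset.Ico (blockStart n b) (blockStart n (b + 1)) \ neutralColumns n e).card ≤ half n := by
  have hcard : (Finset.Ico (blockStart n b) (blockStart n (b + 1))).card = mult n b := by
    rw [Nat.card_Ico, blockStart_succ n h1, Nat.add_sub_cancel_left]
  by_cases hl : half n < mult n b
  · obtain ⟨hb, hm⟩ := hn.mem_insertBlocks_of_half_lt h1 h2 hl
    have := hn.mem_neutralColumns_bounds he hb
    have hlt := Finset.card_lt_card (Finset.ssubset_iff_of_subset (Finset.sdiff_subset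
      (s := Finset.Ico (blockStart n b) (blockStart n (b + 1))) (t := neutralColumns n e)) |>.mpr
      ⟨blockStart n b + e, by rw [Finset.mem_Ico]; omega,
        fun h => (Finset.mem_sdiff.mp h).2 (mem_neutralColumns.mpr ⟨b, hb, rfl⟩)⟩)
    omega
  · exact (Finset.card_le_card Finset.sdiff_subset).trans (by omega)

lemma two_mul_half_le : 2 * half n ≤ n 1 := by
  simp only [half]
  omega

lemma two_mul_half_lt_of_mem {e c : ℕ} (hc : c ∈ neutralColumns n e) : 2 * half n < n 1 := by
  obtain ⟨i, hi, -⟩ := mem_neutralColumns.mp hc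
  have := snd_eq_of_odd (odd_of_mem_insertBlocks hi)
  omega

lemma greenRow_mem (hn : MiddleCone n) {s e : ℕ} (hs : s ≤ half n) (c : ℕ) :
    1 ≤ insertedRow (half n) s (n 1) (neutralColumns n e) c ∧
      insertedRow (half n) s (n 1) (neutralColumns n e) c ≤ n 1 := by
  by_cases hc : c ∈ neutralColumns n e
  · have := hn.three_le_snd
    rw [insertedRow_of_mem hc]
    omega
  · have := insertedRow_mem_Icc (s := s) (v := n 1)
      (fun p hp => one_le_of_mem_neutralColumns hp) hn.half_pos hc
    have := two_mul_half_le (n := n)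
    omega

lemma greenRow_inj (hn : MiddleCone n) {s e : ℕ} (hs : s ≤ half n) (he : e ≤ 1) {c d : ℕ}
    (hc : 1 ≤ c) (hc' : c ≤ n 2) (hd : 1 ≤ d) (hd' : d ≤ n 2) (hb : blueL n c = blueL n d)
    (hg : insertedRow (half n) s (n 1) (neutralColumns n e) c =
      insertedRow (half n) s (n 1) (neutralColumns n e) d) : c = d := by
  obtain ⟨b1, b2, b3, b4⟩ := blueL_spec hn.fst_pos hc hc'
  obtain ⟨-, -, b5, b6⟩ := blueL_spec hn.fst_pos hd hd'
  rw [← hb] at b5 b6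
  have hf := hn.card_block_sdiff_le he b1 b2
  have key := fun {x y : ℕ} => insertedRow_ne (P := neutralColumns n e) (s := s) (v := n 1)
    (c := x) (d := y) (fun p hp => one_le_of_mem_neutralColumns hp) hn.half_pos hf
    (fun p hp => by have := two_mul_half_lt_of_mem hp; omega) (by
      -- A neutral column determines its block, so a block contains at most one neutral per side.
      intro p hp p' hp' h1 h2 h3 h4
      obtain ⟨i, hi, rfl⟩ := mem_neutralColumns.mp hp
      obtain ⟨j, hj, rfl⟩ := mem_neutralColumns.mp hp'
      have hi' := (hn.mem_neutralColumns_bounds he hi).2.1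
      have hj' := (hn.mem_neutralColumns_bounds he hj).2.1
      rw [blueL_eq b2 h1 h2] at hi'
      rw [blueL_eq b2 h3 h4] at hj'
      rw [← hi', ← hj'])
  rcases lt_trichotomy c d with h | h | h
  · exact absurd hg (key hc b3 h b6)
  · exact h
  · exact absurd hg.symm (key hd b5 h b4)

lemma three_le_card_greenRow (hn : MiddleCone n) {s e j : ℕ} (he : e ≤ 1) (hj : j < half n) :
    3 ≤ ((Finset.Icc 1 (n 2)).filter fun c =>
      insertedRow (half n) s (n 1) (neutralColumns n e) c = s + j + 1).card := by
  refine le_card_insertedRow_eq (fun p hp => one_le_of_mem_neutralColumns hp) hj fun t ht => ?_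
  have h1 := hn.three_mul_half_add_card_le
  have h2 : half n * t ≤ half n * 2 := Nat.mul_le_mul_left _ (by omega)
  rw [hn.card_sdiff_neutralColumns he]
  omega

lemma card_insertBlocks_le_card_greenRow (hn : MiddleCone n) {s e : ℕ} (he : e ≤ 1) :
    (insertBlocks n).card ≤ ((Finset.Icc 1 (n 2)).filter fun c =>
      insertedRow (half n) s (n 1) (neutralColumns n e) c = n 1).card := by
  rw [← hn.card_neutralColumns he]
  exact Finset.card_le_card fun c hc =>
    Finset.mem_filter.mpr ⟨hn.neutralColumns_subset he hc, insertedRow_of_mem hc⟩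

/-- Every blue value occurs at least three times. -/
lemma three_le_blue_count (hn : MiddleCone n) {a : ℕ} (h1 : 1 ≤ a) (h2 : a ≤ n 0) :
    3 ≤ ((Finset.Icc 1 (n 2)).filter fun c => blueL n c = a).card +
      ((Finset.Icc 1 (n 2)).filter fun c => blueL n c % n 0 + 1 = a).card := by
  have sub : ∀ b, 1 ≤ b → b ≤ n 0 → ∀ p : ℕ → Prop, [DecidablePred p] → p b →
      mult n b ≤ ((Finset.Icc 1 (n 2)).filter fun c => p (blueL n c)).card := by
    intro b hb hb' p _ hp
    have hcard : (Finset.Ico (blockStart n b) (blockStart n (b + 1))).card = mult n b := by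
      rw [Nat.card_Ico, blockStart_succ n hb, Nat.add_sub_cancel_left]
    rw [← hcard]
    refine Finset.card_le_card fun c hc => ?_
    rw [Finset.mem_Ico] at hc
    rw [Finset.mem_filter, Finset.mem_Icc, blueL_eq hb' hc.1 hc.2]
    have h3 := blockStart_mono n hb
    have h4 := blockStart_mono n (Nat.succ_le_succ hb')
    rw [blockStart_one] at h3
    rw [Nat.succ_eq_add_one, Nat.succ_eq_add_one, blockStart_end n hn.fst_pos] at h4
    exact ⟨by omega, hp⟩
  have hL := sub a h1 h2 (· = a) rfl
  -- The value `a` comes from block `a` on the left and from its cyclic predecessor on the right;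
  -- for `a = 1` the predecessor is block `n₁`.
  rcases h1.lt_or_eq with h | rfl
  · obtain ⟨b, rfl⟩ := Nat.exists_eq_add_of_lt h
    have hR := sub (1 + b) (by omega) (by omega) (fun x => x % n 0 + 1 = 1 + b + 1)
      (by rw [Nat.mod_eq_of_lt (by omega)])
    have := hn.three_le_mult_add_mult (show 1 + b < n 0 by omega)
    omega
  · have hR := sub (n 0) hn.fst_pos le_rfl (fun x => x % n 0 + 1 = 1) (by rw [Nat.mod_self])
    have := hn.two_le_mult_one
    have := hn.one_le_mult (n 0)
    omega

/-- Neutrals on different sides have incompatible blue entries. -/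
lemma neutral_cross (hn : MiddleCone n) {c d : ℕ} (hd : d ∈ neutralColumns n 0)
    (hc : c ∈ neutralColumns n 1) :
    c ≠ d ∧ blueL n d ≠ blueL n c % n 0 + 1 ∧ blueL n c ≠ blueL n d % n 0 + 1 := by
  obtain ⟨i, hi, rfl⟩ := mem_neutralColumns.mp hd
  obtain ⟨j, hj, rfl⟩ := mem_neutralColumns.mp hc
  have hi' := (hn.mem_neutralColumns_bounds (Nat.zero_le _) hi).2.1
  have hj' := (hn.mem_neutralColumns_bounds le_rfl hj).2.1
  refine ⟨fun h => ?_, ?_, ?_⟩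
  · rw [h, hi'] at hj'
    subst hj'
    omega
  · rw [hi', hj']
    exact hn.insertBlocks_not_adjacent hj hi
  · rw [hi', hj']
    exact hn.insertBlocks_not_adjacent hi hj

/-! ### The green rows of the two sides. -/

lemma greenL_eq (n : Fin 3 → ℕ) :
    greenL n = insertedRow (half n) 0 (n 1) (neutralColumns n 0) := by
  funext c
  rw [greenL, insertPositions_eq]

lemma greenR_eq (n : Fin 3 → ℕ) :
    greenR n = insertedRow (half n) (half n) (n 1) (neutralColumns n 1) := by
  funext c
  rw [greenR, image_insertPositions_eq]

lemma greenL_le (hn : MiddleCone n) {c : ℕ} (hc : c ∉ neutralColumns n 0) :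
    greenL n c ≤ half n := by
  have := insertedRow_mem_Icc (s := 0) (v := n 1)
    (fun p hp => one_le_of_mem_neutralColumns hp) hn.half_pos hc
  rw [greenL_eq]
  omega

lemma greenL_of_mem {c : ℕ} (hc : c ∈ neutralColumns n 0) : greenL n c = n 1 := by
  rw [greenL_eq, insertedRow_of_mem hc]

lemma greenR_of_mem {c : ℕ} (hc : c ∈ neutralColumns n 1) : greenR n c = n 1 := by
  rw [greenR_eq, insertedRow_of_mem hc]

lemma greenR_bounds (hn : MiddleCone n) {c : ℕ} (hc : c ∉ neutralColumns n 1) :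
    half n < greenR n c ∧ greenR n c ≤ 2 * half n := by
  have := insertedRow_mem_Icc (s := half n) (v := n 1)
    (fun p hp => one_le_of_mem_neutralColumns hp) hn.half_pos hc
  rw [greenR_eq]
  omega

/-- Periodic entries fill `1, …, f` on the left and `f + 1, …, 2f` on the right, while a neutral, if
there is one, exceeds `2f`. -/
lemma mem_of_greenL_eq_greenR (hn : MiddleCone n) {c d : ℕ} (h : greenL n d = greenR n c) :
    d ∈ neutralColumns n 0 ∧ c ∈ neutralColumns n 1 := by
  have hd : d ∈ neutralColumns n 0 := by
    by_contra hd
    have h1 := hn.greenL_le hd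
    by_cases hc : c ∈ neutralColumns n 1
    · have h2 := greenR_of_mem hc
      have h3 := two_mul_half_lt_of_mem hc
      omega
    · have h2 := (hn.greenR_bounds hc).1
      omega
  refine ⟨hd, ?_⟩
  by_contra hc
  have h1 := greenL_of_mem hd
  have h2 := two_mul_half_lt_of_mem hd
  have h3 := (hn.greenR_bounds hc).2
  omega

/-- Every periodic green value occurs at least three times on its side. -/
lemma three_le_green_count (hn : MiddleCone n) {a : ℕ} (h1 : 1 ≤ a) (h2 : a ≤ 2 * half n) :
    (a ≤ half n ∧ 3 ≤ ((Finset.Icc 1 (n 2)).filter fun c => greenL n c = a).card) ∨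
      (half n < a ∧ 3 ≤ ((Finset.Icc 1 (n 2)).filter fun c => greenR n c = a).card) := by
  rcases le_or_gt a (half n) with h | h
  · have := hn.three_le_card_greenRow (s := 0) (Nat.zero_le 1) (show a - 1 < half n by omega)
    rw [show 0 + (a - 1) + 1 = a by omega] at this
    exact Or.inl ⟨h, by rwa [greenL_eq]⟩
  · have := hn.three_le_card_greenRow (s := half n) le_rfl
      (show a - half n - 1 < half n by omega)
    rw [show half n + (a - half n - 1) + 1 = a by omega] at this
    exact Or.inr ⟨h, by rwa [greenR_eq]⟩

end MiddleCone

/-! ### The constructed matrices are column systems. -/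

namespace MiddleCone

variable {n : Fin 3 → ℕ}

lemma mem_leftSide {w : Point} :
    w ∈ leftSide n ↔ ∃ c, 1 ≤ c ∧ c ≤ n 2 ∧ w = ![blueL n c, greenL n c, c] := by
  simp [leftSide, and_assoc, eq_comm]

lemma mem_rightSide {w : Point} :
    w ∈ rightSide n ↔ ∃ c, 1 ≤ c ∧ c ≤ n 2 ∧ w = ![blueL n c % n 0 + 1, greenR n c, c] := by
  simp [rightSide, blueR, and_assoc, eq_comm]

/-- The construction without replacement. -/
theorem isColumnSystem (hn : MiddleCone n) (h : ¬ (Odd (n 1) ∧ (longBlocks n).card ≤ 1)) :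
    IsColumnSystem n (blueL n) (greenL n) (greenR n) (leftSide n ∪ rightSide n) where
  three_le := hn.three_le_fst
  mem_iff w := by
    rw [Finset.mem_union, mem_leftSide, mem_rightSide, ← exists_or]
    exact exists_congr fun c => by tauto
  blue_mem c h1 h2 := ⟨(blueL_spec hn.fst_pos h1 h2).1, (blueL_spec hn.fst_pos h1 h2).2.1⟩
  greenL_mem c _ _ := by
    rw [greenL_eq]
    exact hn.greenRow_mem (Nat.zero_le _) c
  greenR_mem c _ _ := by
    rw [greenR_eq]
    exact hn.greenRow_mem le_rfl c
  left c d hc hc' hd hd' hb hg := by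
    rw [greenL_eq] at hg
    exact hn.greenRow_inj (Nat.zero_le _) (Nat.zero_le _) hc hc' hd hd' hb hg
  right c d hc hc' hd hd' hb hg := by
    rw [greenR_eq] at hg
    exact hn.greenRow_inj le_rfl le_rfl hc hc' hd hd' hb hg
  cross c d _ _ _ _ hg :=
    hn.neutral_cross (hn.mem_of_greenL_eq_greenR hg).1 (hn.mem_of_greenL_eq_greenR hg).2
  blue_count a h1 h2 := hn.three_le_blue_count h1 h2
  green_count a h1 h2 := by
    by_cases ha : a ≤ 2 * half n
    · have := hn.three_le_green_count h1 ha
      omega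
    · have hne : ¬ Even (n 1) := fun he =>
        ha (h2.trans (Nat.two_mul_div_two_of_even he).ge)
      have ho := Nat.not_even_iff_odd.mp hne
      have hodd := snd_eq_of_odd ho
      obtain rfl : a = n 1 := by omega
      -- At least two long blocks give the neutral value at least two occurrences on each side.
      have hL := hn.card_insertBlocks_le_card_greenRow (s := 0) (Nat.zero_le 1)
      have hR := hn.card_insertBlocks_le_card_greenRow (s := half n) le_rfl
      have hc : 1 < (longBlocks n).card := by
        by_contra! hc
        exact h ⟨ho, hc⟩
      rw [insertBlocks, if_neg hne, if_pos hc] at hL hR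
      rw [greenL_eq, greenR_eq]
      omega

section Replacement

variable (ho : Odd (n 1)) (hl : (longBlocks n).card ≤ 1)

include ho hl

lemma insertBlocks_eq_singleton : insertBlocks n = {1} := by
  rw [insertBlocks, if_neg (Nat.not_even_iff_odd.mpr ho), if_neg (not_lt.mpr hl)]

lemma mem_neutralColumns_iff {e c : ℕ} : c ∈ neutralColumns n e ↔ c = 1 + e := by
  rw [mem_neutralColumns, insertBlocks_eq_singleton ho hl]
  simp [blockStart_one, eq_comm]

lemma blueL_neutral (hn : MiddleCone n) {e : ℕ} (he : e ≤ 1) : blueL n (1 + e) = 1 := by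
  have h1 : 1 ∈ insertBlocks n := by simp [insertBlocks_eq_singleton ho hl]
  have := (hn.mem_neutralColumns_bounds he h1).2.1
  rwa [blockStart_one] at this

/-- There is a column at which the replacement can be made. -/
theorem exists_replaceable (hn : MiddleCone n) :
    ∃ x z, ![x, 1, z] ∈ leftSide n ∧ x ≠ 1 ∧ x ≠ 2 ∧ x ≠ n 0 := by
  have hf := hn.half_pos
  have h2 := hn.three_mul_half_add_two_le ho
  have h0 := hn.three_le_fst
  have hle : ∀ i, 1 ≤ i → i ≤ n 0 → i ≠ 1 → mult n i ≤ half n := by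
    intro i hi hi' hne
    by_contra! hlt
    exact hne (hn.eq_one_of_mem_longBlocks ho hl (mem_longBlocks.mpr ⟨⟨hi, hi'⟩, hlt⟩))
  -- With the neutral in column `1`, the third green `1` is in column `2f + 2`. The first two blocks
  -- end by column `2f + 1`, and the last one, of length at most `f`, starts after column `2f + 2`
  -- because `n₃ ≥ 3f + 2`.
  obtain ⟨b1, b2, b3, b4⟩ := blueL_spec hn.fst_pos (show 1 ≤ 2 + half n * 2 by omega)
    (show 2 + half n * 2 ≤ n 2 by omega)
  have s1 := blockStart_one n
  have s2 := blockStart_succ n (le_refl 1)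
  have s3 := blockStart_succ n (show 1 ≤ 2 by norm_num)
  have s4 := blockStart_succ n (show 1 ≤ n 0 by omega)
  rw [blockStart_end n hn.fst_pos] at s4
  have m1 := hn.mult_le_half_add_one ho 1
  have m2 := hle 2 (by norm_num) (by omega) (by norm_num)
  have m3 := hle (n 0) (by omega) le_rfl (by omega)
  have hg : greenL n (2 + half n * 2) = 1 := by
    have hnot : 2 + half n * 2 ∉ neutralColumns n 0 := by
      rw [mem_neutralColumns_iff ho hl]
      omega
    have hs : neutralColumns n 0 = {1} := by
      ext c
      rw [mem_neutralColumns_iff ho hl, Finset.mem_singleton]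
    have hidx : periodicIndex (neutralColumns n 0) (2 + half n * 2) = half n * 2 := by
      rw [periodicIndex, hs, Finset.card_sdiff_of_subset (by simp; omega), Nat.card_Ico,
        Finset.card_singleton]
      omega
    rw [greenL_eq, insertedRow_of_notMem (fun p hp => one_le_of_mem_neutralColumns hp) hnot, hidx,
      Nat.mul_mod_right]
  refine ⟨blueL n (2 + half n * 2), 2 + half n * 2,
    mem_leftSide.mpr ⟨2 + half n * 2, by omega, by omega, by rw [hg]⟩, ?_, ?_, ?_⟩
  · intro h
    rw [h] at b4
    norm_num at b4 s2
    omega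
  · intro h
    rw [h] at b4
    norm_num at b4 s2 s3
    omega
  · intro h
    rw [h] at b3
    omega

/-- The construction with replacement. -/
theorem isColumnSystem_update (hn : MiddleCone n) {z : ℕ} (hz1 : 1 ≤ z) (hz2 : z ≤ n 2)
    (hzg : greenL n z = 1) (hx1 : blueL n z ≠ 1) (hx2 : blueL n z ≠ 2) (hx3 : blueL n z ≠ n 0) :
    IsColumnSystem n (blueL n) (Function.update (greenL n) z (n 1)) (greenR n)
      (insert ![blueL n z, n 1, z] ((leftSide n).erase ![blueL n z, 1, z]) ∪ rightSide n) where
  three_le := hn.three_le_fst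
  mem_iff w := by
    rw [Finset.mem_union, Finset.mem_insert, Finset.mem_erase, mem_leftSide, mem_rightSide]
    constructor
    · rintro ((rfl | ⟨hne, c, h1, h2, rfl⟩) | ⟨c, h1, h2, rfl⟩)
      · exact ⟨z, hz1, hz2, Or.inl (by rw [Function.update_self])⟩
      · refine ⟨c, h1, h2, Or.inl ?_⟩
        rw [Function.update_of_ne]
        rintro rfl
        exact hne (by rw [hzg])
      · exact ⟨c, h1, h2, Or.inr rfl⟩
    · rintro ⟨c, h1, h2, rfl | rfl⟩
      · refine Or.inl ?_
        by_cases hc : c = z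
        · subst hc
          exact Or.inl (by rw [Function.update_self])
        · rw [Function.update_of_ne hc]
          exact Or.inr ⟨fun he => hc (congrFun he 2), c, h1, h2, rfl⟩
      · exact Or.inr ⟨c, h1, h2, rfl⟩
  blue_mem c h1 h2 := ⟨(blueL_spec hn.fst_pos h1 h2).1, (blueL_spec hn.fst_pos h1 h2).2.1⟩
  greenL_mem c _ _ := by
    rw [Function.update_apply]
    split_ifs
    · exact ⟨by have := hn.three_le_snd; omega, le_rfl⟩
    · rw [greenL_eq]
      exact hn.greenRow_mem (Nat.zero_le _) c
  greenR_mem c _ _ := by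
    rw [greenR_eq]
    exact hn.greenRow_mem le_rfl c
  left c d hc hc' hd hd' hb hg := by
    -- The only other left neutral lies in block `1`, so the new one repeats no blue-green pair.
    have aux : ∀ y, greenL n y = n 1 → blueL n y ≠ blueL n z := by
      intro y hy hby
      have hmem : y ∈ neutralColumns n 0 := by
        by_contra hy'
        have := hn.greenL_le hy'
        have := snd_eq_of_odd ho
        omega
      rw [mem_neutralColumns_iff ho hl] at hmem
      rw [hmem, blueL_neutral ho hl hn (Nat.zero_le _)] at hby
      exact hx1 hby.symm
    simp only [Function.update_apply] at hg
    split_ifs at hg with h1 h2 h2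
    · exact h1.trans h2.symm
    · exact absurd (by rw [← hb, h1]) (aux d hg.symm)
    · exact absurd (by rw [hb, h2]) (aux c hg)
    · rw [greenL_eq] at hg
      exact hn.greenRow_inj (Nat.zero_le _) (Nat.zero_le _) hc hc' hd hd' hb hg
  right c d hc hc' hd hd' hb hg := by
    rw [greenR_eq] at hg
    exact hn.greenRow_inj le_rfl le_rfl hc hc' hd hd' hb hg
  cross c d _ _ _ _ hg := by
    rw [Function.update_apply] at hg
    split_ifs at hg with h
    -- The only right neutral is in column `2`, with blue entries `1` on the left and `2` on the
    -- right. The three exclusions on the blue entry of `z` give the three parts of `cross`.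
    · subst h
      have hmem : c ∈ neutralColumns n 1 := by
        by_contra hc
        have := (hn.greenR_bounds hc).2
        have := snd_eq_of_odd ho
        omega
      rw [mem_neutralColumns_iff ho hl] at hmem
      have hb := blueL_neutral ho hl hn (e := 1) le_rfl
      have h0 := hn.three_le_fst
      have hd := blueL_spec hn.fst_pos hz1 hz2
      rw [hmem, hb, Nat.mod_eq_of_lt (by omega), Nat.mod_eq_of_lt (by omega)]
      refine ⟨fun h => ?_, hx2, by omega⟩
      rw [← h] at hx1
      exact hx1 hb
    · exact hn.neutral_cross (hn.mem_of_greenL_eq_greenR hg).1 (hn.mem_of_greenL_eq_greenR hg).2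
  blue_count a h1 h2 := hn.three_le_blue_count h1 h2
  green_count a h1 h2 := by
    have hodd := snd_eq_of_odd ho
    have hf := hn.half_pos
    have h3 := hn.three_mul_half_add_two_le ho
    have hlarge := three_le_green_count hn h1
    by_cases ha : a ≤ 2 * half n
    · rcases hlarge ha with ⟨ha', hcard⟩ | ⟨ha', hcard⟩
      · refine le_add_right ?_
        have hsub : ((Finset.Icc 1 (n 2)).filter fun c => greenL n c = a).erase z ⊆
            (Finset.Icc 1 (n 2)).filter fun c => Function.update (greenL n) z (n 1) c = a := by
          intro c hc
          rw [Finset.mem_erase, Finset.mem_filter] at hc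
          rw [Finset.mem_filter, Function.update_of_ne hc.1]
          exact hc.2
        refine le_trans ?_ (Finset.card_le_card hsub)
        by_cases h1a : a = 1
        · subst h1a
          -- The replacement removes one green `1`, so four are needed beforehand: the fourth has
          -- periodic index `3f`, below the `n₃ - 1` available.
          have hfour := le_card_insertedRow_eq (s := 0) (v := n 1) (K := 4) (N := n 2)
            (P := neutralColumns n 0) (fun p hp => one_le_of_mem_neutralColumns hp) hf
            (fun t ht => by
              have : half n * t ≤ half n * 3 := Nat.mul_le_mul_left _ (by omega)
              rw [hn.card_sdiff_neutralColumns (Nat.zero_le 1), insertBlocks_eq_singleton ho hl,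
                Finset.card_singleton]
              omega)
          rw [← greenL_eq] at hfour
          have := Finset.pred_card_le_card_erase (a := z)
            (s := (Finset.Icc 1 (n 2)).filter fun c => greenL n c = 1)
          simp only [zero_add] at hfour
          omega
        · rw [Finset.erase_eq_of_notMem]
          · exact hcard
          · rw [Finset.mem_filter, hzg]
            exact fun h => h1a h.2.symm
      · exact le_add_left hcard
    · obtain rfl : a = n 1 := by omega
      have hR := hn.card_insertBlocks_le_card_greenRow (s := half n) le_rfl
      rw [insertBlocks_eq_singleton ho hl, Finset.card_singleton, ← greenR_eq] at hR
      have h1z : 1 ≠ z := by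
        rintro rfl
        exact hx1 (blueL_neutral ho hl hn (Nat.zero_le 1))
      -- The neutral value occurs in columns `1` and `z` on the left; the right neutral is the third
      -- occurrence.
      have hL : ({1, z} : Finset ℕ) ⊆
          (Finset.Icc 1 (n 2)).filter fun c => Function.update (greenL n) z (n 1) c = n 1 := by
        intro c hc
        rw [Finset.mem_insert, Finset.mem_singleton] at hc
        rw [Finset.mem_filter, Finset.mem_Icc]
        rcases hc with rfl | rfl
        · refine ⟨by omega, ?_⟩
          rw [Function.update_of_ne h1z]
          exact greenL_of_mem ((mem_neutralColumns_iff ho hl).mpr rfl)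
        · exact ⟨⟨hz1, hz2⟩, Function.update_self ..⟩
      have := Finset.card_le_card hL
      rw [Finset.card_pair h1z] at this
      omega

end Replacement

theorem exists_isConstructed (hn : MiddleCone n) : ∃ W, IsConstructed n W := by
  unfold IsConstructed
  split_ifs with h
  · obtain ⟨x, z, hx⟩ := exists_replaceable h.1 h.2 hn
    exact ⟨_, x, z, hx.1, hx.2.1, hx.2.2.1, hx.2.2.2, rfl⟩
  · exact ⟨_, rfl⟩

theorem exists_isColumnSystem (hn : MiddleCone n) {W : Finset Point} (hW : IsConstructed n W) :
    ∃ bL gL gR, IsColumnSystem n bL gL gR W := by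
  unfold IsConstructed at hW
  split_ifs at hW with h
  · obtain ⟨x, z, hmem, hx1, hx2, hx3, rfl⟩ := hW
    obtain ⟨c, h1, h2, he⟩ := mem_leftSide.mp hmem
    obtain rfl : z = c := congrFun he 2
    obtain rfl : x = blueL n z := congrFun he 0
    exact ⟨_, _, _, isColumnSystem_update h.1 h.2 hn h1 h2 (congrFun he 1).symm hx1 hx2 hx3⟩
  · exact ⟨_, _, _, hW ▸ hn.isColumnSystem h⟩

end MiddleCone

end LandmarkGraph

theorem mainTheorem5 (n : Fin 3 → ℕ) (hn : LandmarkGraph.MiddleCone n) :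
    (∃ W, LandmarkGraph.IsConstructed n W) ∧
    ∀ W, LandmarkGraph.IsConstructed n W →
      LandmarkGraph.IsBasicLandmarkSystem n W ∧
      LandmarkGraph.SticksArePink W ∧
      ¬ LandmarkGraph.HasBadFourCycle W ∧
      LandmarkGraph.ResolvesK n W ∧
      LandmarkGraph.ResolvesK (LandmarkGraph.bump n) (insert (LandmarkGraph.bump n) W) := by
  refine ⟨hn.exists_isConstructed, fun W hW => ?_⟩
  obtain ⟨bL, gL, gR, h⟩ := hn.exists_isColumnSystem hW
  have h1 := h.isBasicLandmarkSystem
  have h2 := h.sticksArePink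
  have h3 := h.not_hasBadFourCycle
  exact ⟨h1, h2, h3, h1.resolvesK h2 h3, h1.resolvesK_bump h2 h3⟩
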